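/- Let $T$ be a locally finite rooted tree with root $o$, let $\mathrm{Aut}(T)$ be its group of root-fixing automorphisms, and let $\partial T$ be its visual boundary (geodesic rays from $o$, with the topology of pointwise convergence). For $G\le \mathrm{Aut}(T)$ and a vertex $v$, let $\mathrm{rist}_G(v)$ be the subgroup of elements of $G$ that fix every vertex that is not below $v$, and for $n\ge 1$ let $\mathrm{rist}_G(n)$ be the subgroup generated by all $\mathrm{rist}_G(v)$ with $v$ at level $n$. The group $G$ is a branch group if it is transitive on each level of $T$ and $\mathrm{rist}_G(n)$ has finite index in $G$ for every $n\ge 1$. If $G$ acts by homeomorphisms on a compact space $X$, the essential support of the action is $Y=\bigcap_{n\ge 1}\mathrm{supp}_X(\mathrm{rist}_G(n)')$, where $K'$ is the derived subgroup of $K$ and $\mathrm{supp}_X(K)$ is the closure of the set of points of $X$ not fixed by $K$; it is a closed $G$-invariant set. A Bratteli diagram $B$ consists of finite non-empty sets $(V_n)_{n\ge 0}$, $(E_n)_{n\ge 1}$ and surjective maps $\mathsf{o}\colon E_n\to V_{n-1}$, $\mathsf{t}\colon E_n\to V_n$. Its path space $X_B$ is the set of infinite paths $e_1e_2\cdots$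 with $e_i\in E_i$ and $\mathsf{t}(e_i)=\mathsf{o}(e_{i+1})$, with the topology induced from the product of the discrete topologies. For a finite path $\gamma=e_1\cdots e_n$ let $\mathsf{t}(\gamma)=\mathsf{t}(e_n)$ and let $C_\gamma\subset X_B$ be the set of infinite paths that begin with $\gamma$; if $\gamma,\eta$ are finite paths with $\mathsf{t}(\gamma)=\mathsf{t}(\eta)$, the prefix replacement $F_{\gamma,\eta}\colon C_\gamma\to C_\eta$ replaces the prefix $\gamma$ by $\eta$. A homeomorphism $g$ of $X_B$ is of bounded type if all but finitely many $x\in X_B$ are such that the germ of $g$ at $x$ is the germ of a prefix replacement, and if, for $v\in\bigsqcup_n V_n$, the number of finite paths $\gamma$ with $\mathsf{t}(\gamma)=v$ such that $g|_{C_\gamma}$ is not a prefix replacement $F_{\gamma,\eta}$ is bounded independently of $v$. A group $H$ of homeomorphisms of $X_B$ is of strongly bounded type if all its elements are of bounded type and if, for every $x\in X_B$, the isotropy group $H_x/H_x^0$ is locally finite, where $H_x$ is the stabiliser of $x$ and $H_x^0$ is the subgroup of elements of $H$ that fix a neighbourhood of $x$ pointwise. A group of homeomorphisms of a totally disconnected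 compact space $X$ is of strongly bounded type if some homeomorphism from $X$ to the path space of a Bratteli diagram conjugates it to a group of strongly bounded type. Theorem. Let $G\le \mathrm{Aut}(T)$ be a finitely generated branch group and let $H$ be a group of homeomorphisms of strongly bounded type of a totally disconnected compact space $X$. Let $\rho\colon G\to H$ be an injective homomorphism and let $Y\subset X$ be the essential support of the $G$-action on $X$ induced by $\rho$. Then there exists a continuous $G$-equivariant map $q\colon Y\to\partial T$, and, if $\partial T$ is infinite, $q$ is surjective. -/

import Mathlib

open Topology

/-! ### Rooted trees, their automorphisms and their boundary -/

section RootedTrees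

variable {V : Type*}

/-- The group `Aut(T)` of automorphisms of the graph `T` that fix the root `o`. -/
def rootedAut (T : SimpleGraph V) (o : V) : Subgroup (T ≃g T) where
  carrier := {g | g o = o}
  one_mem' := rfl
  mul_mem' := by
    intro a b ha hb
    change a (b o) = o
    rw [show b o = o from hb]
    exact ha
  inv_mem' := by
    intro a ha
    change a.symm o = o
    exact a.toEquiv.symm_apply_eq.mpr (Eq.symm ha)

variable {T : SimpleGraph V} {o : V}

instance : MulAction (rootedAut T o) V where
  smul g v := (g : T ≃g T) v
  one_smul _ := rfl
  mul_smul _ _ _ := rfl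

theorem rootedAut_smul_def (g : rootedAut T o) (v : V) : g • v = (g : T ≃g T) v := rfl

theorem rootedAut_smul_root (g : rootedAut T o) : g • o = o := g.2

theorem rootedAut_adj (g : rootedAut T o) {v w : V} (h : T.Adj v w) : T.Adj (g • v) (g • w) :=
  (g : T ≃g T).map_rel_iff.mpr h

theorem rootedAut_reachable (g : rootedAut T o) {v w : V} (h : T.Reachable v w) :
    T.Reachable (g • v) (g • w) := by
  obtain ⟨p⟩ := h
  exact ⟨p.map (g : T ≃g T).toHom⟩

theorem rootedAut_dist_le (g : rootedAut T o) {v w : V} (h : T.Reachable v w) :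
    T.dist (g • v) (g • w) ≤ T.dist v w := by
  obtain ⟨p, hp⟩ := h.exists_walk_length_eq_dist
  have h1 := SimpleGraph.dist_le (p.map (g : T ≃g T).toHom)
  rw [SimpleGraph.Walk.length_map, hp] at h1
  exact h1

theorem rootedAut_dist (g : rootedAut T o) (v w : V) : T.dist (g • v) (g • w) = T.dist v w := by
  by_cases h : T.Reachable v w
  · apply le_antisymm (rootedAut_dist_le g h)
    have h1 := rootedAut_dist_le g⁻¹ (rootedAut_reachable g h)
    rwa [inv_smul_smul, inv_smul_smul] at h1
  · have h' : ¬ T.Reachable (g • v) (g • w) := by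
      intro hr
      have h1 := rootedAut_reachable g⁻¹ hr
      rw [inv_smul_smul, inv_smul_smul] at h1
      exact h h1
    rw [SimpleGraph.dist_eq_zero_of_not_reachable h,
      SimpleGraph.dist_eq_zero_of_not_reachable h']

theorem rootedAut_dist_root (g : rootedAut T o) (v : V) : T.dist o (g • v) = T.dist o v := by
  have h := rootedAut_dist g o v
  rwa [rootedAut_smul_root] at h

/-- The `n`-th level `L(n)`: the vertices at distance `n` from the root. -/
def treeLevel (T : SimpleGraph V) (o : V) (n : ℕ) : Set V := {v | T.dist o v = n}

/-- `w` is below `v` (relative to the root `o`): a geodesic from `o` to `w` passes through `v`. -/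
def IsBelow (T : SimpleGraph V) (o v w : V) : Prop := T.dist o v + T.dist v w = T.dist o w

/-- The visual boundary `∂T`: geodesic rays issued from the root. -/
@[ext]
structure TreeBoundary (T : SimpleGraph V) (o : V) where
  vertex : ℕ → V
  dist_root : ∀ n, T.dist o (vertex n) = n
  adj : ∀ n, T.Adj (vertex n) (vertex (n + 1))

/-- The topology of `∂T`: pointwise convergence of rays, each vertex being isolated. -/
instance : TopologicalSpace (TreeBoundary T o) :=
  TopologicalSpace.induced TreeBoundary.vertex (@Pi.topologicalSpace ℕ (fun _ => V) (fun _ => ⊥))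

/-- `Aut(T)` acts on `∂T`. -/
instance : MulAction (rootedAut T o) (TreeBoundary T o) where
  smul g ξ :=
    { vertex := fun n => g • ξ.vertex n
      dist_root := fun n => (rootedAut_dist_root g _).trans (ξ.dist_root n)
      adj := fun n => rootedAut_adj g (ξ.adj n) }
  one_smul _ := rfl
  mul_smul _ _ _ := rfl

/-- `rist_G(v)`: the elements of `G` that fix pointwise the complement of the subtree `T_v`. -/
def ristVertex (G : Subgroup (rootedAut T o)) (v : V) : Subgroup G where
  carrier := {g | ∀ w, ¬ IsBelow T o v w → g • w = w}
  one_mem' _ _ := rfl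
  mul_mem' := by
    intro a b ha hb w hw
    rw [mul_smul, hb w hw, ha w hw]
  inv_mem' := by
    intro a ha w hw
    rw [inv_smul_eq_iff, ha w hw]

/-- `rist_G(n)`: the subgroup generated by the `rist_G(v)`, where `v` ranges over `L(n)`. -/
def ristLevel (G : Subgroup (rootedAut T o)) (n : ℕ) : Subgroup G :=
  ⨆ v ∈ treeLevel T o n, ristVertex G v

/-- `G` is transitive on every level of `T`. -/
def IsLevelTransitive (G : Subgroup (rootedAut T o)) : Prop :=
  ∀ n, ∀ v ∈ treeLevel T o n, ∀ w ∈ treeLevel T o n, ∃ g : G, g • v = w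

/-- `G ≤ Aut(T)` is a branch group. -/
def IsBranchGroup (G : Subgroup (rootedAut T o)) : Prop :=
  IsLevelTransitive G ∧ ∀ n, 1 ≤ n → (ristLevel G n).FiniteIndex

theorem ristVertex_conj (G : Subgroup (rootedAut T o)) (g : G) (v : V) {k : G}
    (hk : k ∈ ristVertex G v) : g * k * g⁻¹ ∈ ristVertex G (g • v) := by
  intro w hw
  have h : ¬ IsBelow T o v (g⁻¹ • w) := by
    intro hb
    apply hw
    have h1 : T.dist o (g • v) = T.dist o v := rootedAut_dist_root (g : rootedAut T o) v
    have h2 : T.dist o (g • g⁻¹ • w) = T.dist o (g⁻¹ • w) :=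
      rootedAut_dist_root (g : rootedAut T o) (g⁻¹ • w)
    have h3 : T.dist (g • v) (g • g⁻¹ • w) = T.dist v (g⁻¹ • w) :=
      rootedAut_dist (g : rootedAut T o) v (g⁻¹ • w)
    rw [smul_inv_smul] at h2 h3
    unfold IsBelow at hb ⊢
    rw [h1, h2, h3, hb]
  rw [mul_smul, mul_smul, hk _ h, smul_inv_smul]

instance ristLevel_normal (G : Subgroup (rootedAut T o)) (n : ℕ) : (ristLevel G n).Normal := by
  constructor
  intro k hk g
  have h : ristLevel G n ≤ (ristLevel G n).comap (MulAut.conj g).toMonoidHom := by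
    refine iSup₂_le fun v hv k hk => ?_
    have hgv : g • v ∈ treeLevel T o n :=
      (rootedAut_dist_root (g : rootedAut T o) v).trans hv
    exact (le_iSup₂_of_le (f := fun v (_ : v ∈ treeLevel T o n) => ristVertex G v)
      (g • v) hgv le_rfl) (ristVertex_conj G g v hk)
  exact h hk

end RootedTrees

/-! ### Groups of homeomorphisms: supports, germs, essential support -/

section Homeomorphisms

variable {X : Type*} [TopologicalSpace X]

/-- The support `supp_X(K)` of a group `K` acting on `X` through `φ`: the closure of the set of
points that are not fixed by `K`. -/
def actionSupport {G : Type*} [Group G] (φ : G →* (X ≃ₜ X)) (K : Subgroup G) : Set X :=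
  closure {x | ¬ ∀ k ∈ K, φ k x = x}

/-- The essential support of the action `φ` of `G ≤ Aut(T)` on `X`: the intersection over `n ≥ 1`
of the supports of the derived subgroups `rist_G(n)'`. -/
def essentialSupport {V : Type*} {T : SimpleGraph V} {o : V} (G : Subgroup (rootedAut T o))
    (φ : G →* (X ≃ₜ X)) : Set X :=
  ⋂ (n : ℕ) (_ : 1 ≤ n), actionSupport φ ⁅ristLevel G n, ristLevel G n⁆

theorem actionSupport_invariant {G : Type*} [Group G] (φ : G →* (X ≃ₜ X)) (K : Subgroup G)
    [K.Normal] (g : G) {x : X} (hx : x ∈ actionSupport φ K) : φ g x ∈ actionSupport φ K := by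
  have h1 : φ g x ∈ (φ g) '' actionSupport φ K := ⟨x, hx, rfl⟩
  unfold actionSupport at h1 ⊢
  rw [(φ g).image_closure] at h1
  refine closure_mono ?_ h1
  rintro _ ⟨y, hy, rfl⟩ h
  apply hy
  intro k hk
  have h2 := h (g * k * g⁻¹) (Subgroup.Normal.conj_mem ‹_› k hk g)
  have h3 : φ (g * k * g⁻¹) (φ g y) = φ g (φ k y) := by
    change (φ (g * k * g⁻¹) * φ g) y = (φ g * φ k) y
    rw [← map_mul, ← map_mul, inv_mul_cancel_right]
  rw [h3] at h2
  exact (φ g).injective h2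

theorem essentialSupport_invariant {V : Type*} {T : SimpleGraph V} {o : V}
    (G : Subgroup (rootedAut T o)) (φ : G →* (X ≃ₜ X)) (g : G) {x : X}
    (hx : x ∈ essentialSupport G φ) : φ g x ∈ essentialSupport G φ := by
  unfold essentialSupport at hx ⊢
  simp only [Set.mem_iInter] at hx ⊢
  exact fun n hn => actionSupport_invariant φ _ g (hx n hn)

/-- The stabiliser `H_x`. -/
def pointStabilizer (H : Subgroup (X ≃ₜ X)) (x : X) : Subgroup H where
  carrier := {h | (h : X ≃ₜ X) x = x}
  one_mem' := rfl
  mul_mem' := by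
    intro a b ha hb
    change (a : X ≃ₜ X) ((b : X ≃ₜ X) x) = x
    rw [show (b : X ≃ₜ X) x = x from hb]
    exact ha
  inv_mem' := by
    intro a ha
    change (a : X ≃ₜ X).symm x = x
    exact (a : X ≃ₜ X).toEquiv.symm_apply_eq.mpr (Eq.symm ha)

/-- The germ-stabiliser `H_x^0`: the elements of `H` that fix pointwise a neighbourhood of `x`. -/
def germStabilizer (H : Subgroup (X ≃ₜ X)) (x : X) : Subgroup H where
  carrier := {h | ∀ᶠ y in 𝓝 x, (h : X ≃ₜ X) y = y}
  one_mem' := Filter.Eventually.of_forall fun _ => rfl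
  mul_mem' := by
    intro a b ha hb
    filter_upwards [ha, hb] with y hay hby
    change (a : X ≃ₜ X) ((b : X ≃ₜ X) y) = y
    rw [hby, hay]
  inv_mem' := by
    intro a ha
    filter_upwards [ha] with y hay
    change (a : X ≃ₜ X).symm y = y
    exact (a : X ≃ₜ X).toEquiv.symm_apply_eq.mpr (Eq.symm hay)

instance germStabilizer_normal (H : Subgroup (X ≃ₜ X)) (x : X) :
    ((germStabilizer H x).subgroupOf (pointStabilizer H x)).Normal := by
  constructor
  rintro ⟨a, ha⟩ hn ⟨b, hb⟩
  have hn' : ∀ᶠ y in 𝓝 x, (a : X ≃ₜ X) y = y := hn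
  have hbx : (b : X ≃ₜ X).symm x = x := (b : X ≃ₜ X).toEquiv.symm_apply_eq.mpr (Eq.symm hb)
  have hc : Filter.Tendsto (b : X ≃ₜ X).symm (𝓝 x) (𝓝 x) := by
    have := (b : X ≃ₜ X).symm.continuous.tendsto x
    rwa [hbx] at this
  change ∀ᶠ y in 𝓝 x, (b : X ≃ₜ X) ((a : X ≃ₜ X) ((b : X ≃ₜ X).symm y)) = y
  filter_upwards [hc.eventually hn'] with y hy
  rw [hy, Homeomorph.apply_symm_apply]

/-- The isotropy group (group of germs) `H_x / H_x^0`. -/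
abbrev IsotropyGroup (H : Subgroup (X ≃ₜ X)) (x : X) : Type _ :=
  pointStabilizer H x ⧸ (germStabilizer H x).subgroupOf (pointStabilizer H x)

/-- A group is locally finite if all its finitely generated subgroups are finite. -/
def IsLocallyFiniteGroup (G : Type*) [Group G] : Prop :=
  ∀ K : Subgroup G, K.FG → Finite K

/-- Conjugation by a homeomorphism `f : X → Z`, as a homomorphism `Homeo(X) → Homeo(Z)`. -/
def homeoConj {Z : Type*} [TopologicalSpace Z] (f : X ≃ₜ Z) : (X ≃ₜ X) →* (Z ≃ₜ Z) where
  toFun h := (f.symm.trans h).trans f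
  map_one' := by
    ext z
    exact f.apply_symm_apply z
  map_mul' a b := by
    ext z
    change f (a (b (f.symm z))) = f (a (f.symm (f (b (f.symm z)))))
    rw [f.symm_apply_apply]

end Homeomorphisms

/-! ### Bratteli diagrams and homeomorphisms of strongly bounded type -/

/-- A Bratteli diagram. The type `E n` is the set of edges from `V n` to `V (n + 1)`. -/
structure BratteliDiagram where
  V : ℕ → Type
  E : ℕ → Type
  finite_V : ∀ n, Finite (V n)
  nonempty_V : ∀ n, Nonempty (V n)
  finite_E : ∀ n, Finite (E n)
  nonempty_E : ∀ n, Nonempty (E n)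
  src : ∀ n, E n → V n
  tgt : ∀ n, E n → V (n + 1)
  src_surjective : ∀ n, Function.Surjective (src n)
  tgt_surjective : ∀ n, Function.Surjective (tgt n)

namespace BratteliDiagram

variable (B : BratteliDiagram)

/-- The path space `X_B`. -/
@[ext]
structure PathSpace where
  edge : ∀ n, B.E n
  compat : ∀ n, B.tgt n (edge n) = B.src (n + 1) (edge (n + 1))

/-- The topology induced by the product of the discrete topologies. -/
instance : TopologicalSpace B.PathSpace :=
  TopologicalSpace.induced PathSpace.edge (@Pi.topologicalSpace ℕ B.E (fun _ => ⊥))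

/-- Finite paths with `n + 1` edges, starting at the top level. -/
@[ext]
structure FinPath (n : ℕ) where
  edge : ∀ i, i ≤ n → B.E i
  compat : ∀ i (h : i + 1 ≤ n),
    B.tgt i (edge i (Nat.le_of_succ_le h)) = B.src (i + 1) (edge (i + 1) h)

variable {B}

/-- The end vertex of a finite path. -/
def FinPath.target {n : ℕ} (γ : B.FinPath n) : B.V (n + 1) := B.tgt n (γ.edge n le_rfl)

/-- The cylinder `C_γ` of infinite paths that begin with `γ`. -/
def cylinder {n : ℕ} (γ : B.FinPath n) : Set B.PathSpace :=
  {x | ∀ i (h : i ≤ n), x.edge i = γ.edge i h}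

/-- The prefix replacement `F_{γ, η} : C_γ → C_η`, for paths `γ`, `η` with the same end vertex. -/
def prefixReplacement {n : ℕ} (γ η : B.FinPath n) (h : γ.target = η.target)
    (x : cylinder γ) : cylinder η where
  val :=
    { edge := fun i => if hi : i ≤ n then η.edge i hi else x.1.edge i
      compat := by
        intro i
        by_cases h1 : i + 1 ≤ n
        · rw [dif_pos h1, dif_pos (Nat.le_of_succ_le h1)]
          exact η.compat i h1
        · rw [dif_neg h1]
          by_cases h2 : i ≤ n
          · obtain rfl : i = n := by omega
            rw [dif_pos h2, ← x.1.compat i, x.2 i h2]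
            exact h.symm
          · rw [dif_neg h2]
            exact x.1.compat i }
  property := fun _ hi => dif_pos hi

/-- `x` is a singularity of `g`: the germ of `g` at `x` is not the germ of a prefix replacement. -/
def IsSingularity (g : B.PathSpace ≃ₜ B.PathSpace) (x : B.PathSpace) : Prop :=
  ¬ ∃ (n : ℕ) (γ η : B.FinPath n) (h : γ.target = η.target), x ∈ cylinder γ ∧
    ∀ᶠ y in 𝓝 x, ∀ hy : y ∈ cylinder γ, g y = prefixReplacement γ η h ⟨y, hy⟩

/-- The number `A_v(g)` of paths `γ` ending at `v` such that the restriction of `g` to `C_γ` is not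
a prefix replacement `F_{γ, η}`. -/
noncomputable def activity (g : B.PathSpace ≃ₜ B.PathSpace) {n : ℕ} (v : B.V (n + 1)) : ℕ∞ :=
  Set.encard {γ : B.FinPath n | γ.target = v ∧
    ¬ ∃ (η : B.FinPath n) (h : γ.target = η.target),
      ∀ y : cylinder γ, g y = prefixReplacement γ η h y}

/-- `g` is of bounded type: finitely many singularities, and bounded activity. -/
def IsBoundedType (g : B.PathSpace ≃ₜ B.PathSpace) : Prop :=
  {x | IsSingularity g x}.Finite ∧
    ∃ C : ℕ, ∀ (n : ℕ) (v : B.V (n + 1)), activity g v ≤ C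

/-- A group of homeomorphisms of `X_B` of strongly bounded type. -/
def IsStronglyBoundedType (H : Subgroup (B.PathSpace ≃ₜ B.PathSpace)) : Prop :=
  (∀ h ∈ H, IsBoundedType h) ∧ ∀ x, IsLocallyFiniteGroup (IsotropyGroup H x)

end BratteliDiagram

/-- A group of homeomorphisms of `X` is of strongly bounded type if some homeomorphism from `X` to
the path space of a Bratteli diagram conjugates it to a group of strongly bounded type. -/
def IsStronglyBoundedType {X : Type*} [TopologicalSpace X] (H : Subgroup (X ≃ₜ X)) : Prop :=
  ∃ (B : BratteliDiagram) (f : X ≃ₜ B.PathSpace),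
    BratteliDiagram.IsStronglyBoundedType (H.map (homeoConj f))

/-! For y in the essential support and each n, exactly one vertex v of level n accumulates at y, in
the sense that y lies in the support of rist_G(u)' for vertices u below v at every greater depth
(`AccumulatesAt`). These vertices form the ray q(y).

Existence is a pigeonhole on finite levels, because rist_G(n)' lies in the subgroup generated by the
rist_G(u)' with u on level n. Uniqueness rests on three facts. (1) For a finitely generated group
acting through a group of strongly bounded type, the elements trivial near y have finite index in
the stabiliser of y (`IsStronglyBoundedType.relIndex_germThrough`). (2) The orbit of y is exhausted
by finite sets that each group element leaves from a bounded number of points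
(`IsStronglyBoundedType.exists_exhaustion`). Hence, if A × B acts and the A-orbit of y is infinite,
finitely many A-orbits cover the whole orbit, and the stabiliser of y projects onto a subgroup of
finite index in B (`map_snd_stabThrough_index_ne_zero`). (3) If S has finite index in rist_G(v) and
S' is trivial near y, then v does not accumulate at y: for u deep below v, rist_G(u) has many
commuting conjugates, which forces rist_G(u)' ≤ S' (`commutator_le_of_commuting_conjugates`).

Suppose v ≠ w on one level accumulate at y. By (1) and (3) the rist_G(v)-orbit of y is infinite. By
(2) and (1), a finite-index subgroup of rist_G(w) consists of elements b that some a in rist_G(v)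
corrects to an element ab trivial near y. With three vertices, two such corrections of elements of
one factor lie in different, commuting factors and cancel in commutators, which contradicts (3). Two
accumulating vertices produce three: corrected elements fix y and move a deep accumulating vertex
below one of the two.

The map q is continuous because accumulation at a given vertex is a closed condition, and surjective
by compactness and level transitivity. If the levels have bounded size, then some rist_G(n) is
trivial and Y is empty. -/

/-! ### Stabilisers for actions through a homomorphism -/

section ActionStabilizers

variable {X : Type*} [TopologicalSpace X] {Γ : Type*} [Group Γ]

/-- The stabiliser of a point for the action through `φ`. -/
def stabThrough (φ : Γ →* (X ≃ₜ X)) (y : X) : Subgroup Γ where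
  carrier := {g | φ g y = y}
  one_mem' := by
    change φ 1 y = y
    rw [map_one]
    rfl
  mul_mem' := by
    intro a b ha hb
    change φ (a * b) y = y
    rw [map_mul]
    change φ a (φ b y) = y
    rw [show φ b y = y from hb]
    exact ha
  inv_mem' := by
    intro a ha
    change φ a⁻¹ y = y
    rw [map_inv]
    exact (φ a).toEquiv.symm_apply_eq.mpr (Eq.symm ha)

/-- The pointwise fixator of a set for the action through `φ`. -/
def fixThrough (φ : Γ →* (X ≃ₜ X)) (U : Set X) : Subgroup Γ :=
  ⨅ y ∈ U, stabThrough φ y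

/-- The elements that fix a neighbourhood of `y`, for the action through `φ`. -/
def germThrough (φ : Γ →* (X ≃ₜ X)) (y : X) : Subgroup Γ where
  carrier := {g | ∀ᶠ z in 𝓝 y, φ g z = z}
  one_mem' := by
    refine Filter.Eventually.of_forall fun z => ?_
    rw [map_one]
    rfl
  mul_mem' := by
    intro a b ha hb
    filter_upwards [ha, hb] with z hza hzb
    exact (stabThrough φ z).mul_mem hza hzb
  inv_mem' := by
    intro a ha
    filter_upwards [ha] with z hza
    exact (stabThrough φ z).inv_mem hza

variable {φ : Γ →* (X ≃ₜ X)} {y : X}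

theorem mem_stabThrough {g : Γ} : g ∈ stabThrough φ y ↔ φ g y = y := Iff.rfl

theorem mem_germThrough {g : Γ} : g ∈ germThrough φ y ↔ ∀ᶠ z in 𝓝 y, φ g z = z := Iff.rfl

theorem mem_fixThrough {U : Set X} {g : Γ} : g ∈ fixThrough φ U ↔ ∀ z ∈ U, φ g z = z := by
  simp only [fixThrough, Subgroup.mem_iInf, mem_stabThrough]

theorem map_mul_apply (φ : Γ →* (X ≃ₜ X)) (a b : Γ) (z : X) : φ (a * b) z = φ a (φ b z) := by
  rw [map_mul]; rfl

theorem map_one_apply (φ : Γ →* (X ≃ₜ X)) (z : X) : φ 1 z = z := by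
  rw [map_one]; rfl

theorem map_inv_apply_eq_iff (φ : Γ →* (X ≃ₜ X)) (a : Γ) {z w : X} :
    φ a⁻¹ z = w ↔ z = φ a w := by
  rw [map_inv]; exact (φ a).toEquiv.symm_apply_eq

theorem map_inv_apply_self (φ : Γ →* (X ≃ₜ X)) (a : Γ) (z : X) : φ a⁻¹ (φ a z) = z :=
  (map_inv_apply_eq_iff φ a).mpr rfl

theorem map_apply_inv_self (φ : Γ →* (X ≃ₜ X)) (a : Γ) (z : X) : φ a (φ a⁻¹ z) = z :=
  ((map_inv_apply_eq_iff φ a).mp rfl).symm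

theorem germThrough_le_stabThrough : germThrough φ y ≤ stabThrough φ y :=
  fun _ hg => (mem_germThrough.mp hg).self_of_nhds

theorem fixThrough_anti {U W : Set X} (h : U ⊆ W) : fixThrough φ W ≤ fixThrough φ U :=
  fun _ hg => mem_fixThrough.mpr fun z hz => mem_fixThrough.mp hg z (h hz)

theorem conj_mem_germThrough {k s : Γ} (hk : k ∈ germThrough φ y) :
    s * k * s⁻¹ ∈ germThrough φ (φ s y) := by
  have hc : Filter.Tendsto (φ s⁻¹) (𝓝 (φ s y)) (𝓝 y) := by
    have h := (φ s⁻¹).continuous.tendsto (φ s y)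
    rwa [map_inv_apply_self] at h
  rw [mem_germThrough] at hk ⊢
  filter_upwards [hc.eventually hk] with z hz
  rw [map_mul_apply, map_mul_apply, hz, map_apply_inv_self]

/-- A finitely generated group of germs fixing `y` fixes a common neighbourhood of `y`. -/
theorem exists_le_map_fixThrough {Δ : Type*} [Group Δ] (f : Γ →* Δ) {R : Subgroup Δ}
    (hR : R.FG) (hle : R ≤ (germThrough φ y).map f) :
    ∃ U ∈ 𝓝 y, R ≤ (fixThrough φ U).map f := by
  obtain ⟨S, rfl⟩ := hR
  have h : ∀ s : S, ∃ k ∈ germThrough φ y, f k = s := fun s =>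
    hle (Subgroup.subset_closure s.2)
  choose k hk hks using h
  refine ⟨{z | ∀ s : S, φ (k s) z = z}, ?_, ?_⟩
  · exact Filter.eventually_all.mpr fun s => mem_germThrough.mp (hk s)
  · rw [Subgroup.closure_le]
    intro s hs
    exact ⟨k ⟨s, hs⟩, mem_fixThrough.mpr fun z hz => hz ⟨s, hs⟩, hks ⟨s, hs⟩⟩

end ActionStabilizers

/-! ### Isotropy of finitely generated groups with finitely many singular germs -/

section RegularGerms

variable {X : Type*} [TopologicalSpace X] {Γ : Type*} [Group Γ]

/-- If a finitely generated group has finitely many irregular germs, for a notion of regular germ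
that is closed under composition and inverse and has no isotropy, then its isotropy groups are
finitely generated. -/
theorem exists_finite_generating_isotropy (φ : Γ →* (X ≃ₜ X)) (Reg : Γ → X → Prop)
    (hcomp : ∀ g h x, Reg g x → Reg h (φ g x) → Reg (h * g) x)
    (hinv : ∀ g x, Reg g x → Reg g⁻¹ (φ g x))
    (hone : ∀ g x, g ∈ germThrough φ x → Reg g x)
    (hiso : ∀ g x, Reg g x → φ g x = x → g ∈ germThrough φ x)
    (hfin : ∀ g, {x | ¬ Reg g x}.Finite) [hΓ : Group.FG Γ] (y : X) :
    ∃ D : Set Γ, D.Finite ∧ D ⊆ stabThrough φ y ∧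
      ∀ g ∈ stabThrough φ y, ∃ d ∈ Subgroup.closure D, g * d⁻¹ ∈ germThrough φ y := by
  classical
  obtain ⟨S, hS, hSfin⟩ := Monoid.fg_iff.mp (Group.fg_iff_monoid_fg.mp hΓ)
  have ht : ∃ t : X → Γ, ∀ p, (∃ g, φ g y = p) → φ (t p) y = p := by
    choose! t ht using fun p (h : ∃ g, φ g y = p) => h
    exact ⟨t, ht⟩
  obtain ⟨t, ht⟩ := ht
  -- Regular germs without isotropy are determined by their endpoints, so one chosen element `k p x`
  -- represents all regular germs from `p` to `x`.
  have hk : ∃ k : X → X → Γ, ∀ p x, (∃ g, Reg g p ∧ φ g p = x) →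
      Reg (k p x) p ∧ φ (k p x) p = x := by
    choose! k hk using fun p x (h : ∃ g, Reg g p ∧ φ g p = x) => h
    exact ⟨k, hk⟩
  obtain ⟨k, hk⟩ := hk
  have hty : φ (t y) y = y := ht y ⟨1, map_one_apply φ y⟩
  -- The base point and both ends of every irregular germ of a generator.
  set Q : Set X := {y} ∪ ⋃ s ∈ S, ({x | ¬ Reg s x} ∪ φ s '' {x | ¬ Reg s x}) with hQ
  have hQfin : Q.Finite := (Set.finite_singleton y).union
    (hSfin.biUnion fun s _ => (hfin s).union ((hfin s).image _))
  have hyQ : y ∈ Q := Or.inl rfl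
  have hQ1 : ∀ s ∈ S, ∀ x, ¬ Reg s x → x ∈ Q := fun s hs x hx =>
    Or.inr (Set.mem_biUnion hs (Or.inl hx))
  have hQ2 : ∀ s ∈ S, ∀ x, ¬ Reg s x → φ s x ∈ Q := fun s hs x hx =>
    Or.inr (Set.mem_biUnion hs (Or.inr ⟨x, hx, rfl⟩))
  -- Loops at `y`: go to a point of `Q`, follow a regular germ, cross one irregular germ of a
  -- generator, return. The intersection with the stabiliser discards the junk values of `t` and
  -- `k`.
  set D : Set Γ := ({t y} ∪ (fun p => k p y * t p) '' Q ∪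
    (fun a : Γ × X × X => (t (φ a.1 a.2.1))⁻¹ * a.1 * k a.2.2 a.2.1 * t a.2.2) ''
      (S ×ˢ (Q ×ˢ Q))) ∩ stabThrough φ y with hD
  have hDs : D ⊆ stabThrough φ y := Set.inter_subset_right
  have hcl : Subgroup.closure D ≤ stabThrough φ y := (Subgroup.closure_le _).mpr hDs
  refine ⟨D, ?_, hDs, ?_⟩
  · exact (((Set.finite_singleton _).union (hQfin.image _)).union
      ((hSfin.prod (hQfin.prod hQfin)).image _)).inter_of_left _
  have quot_mem : ∀ r k' p x, Reg r p → φ r p = x → Reg k' p → φ k' p = x →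
      r * k'⁻¹ ∈ germThrough φ x := by
    intro r k' p x hr hrx hk' hkx
    have h1 : φ k'⁻¹ x = p := (map_inv_apply_eq_iff φ k').mpr hkx.symm
    have h2 : Reg k'⁻¹ x := by
      have := hinv k' p hk'
      rwa [hkx] at this
    refine hiso _ _ (hcomp _ _ _ h2 (by rwa [h1])) ?_
    rw [map_mul_apply, h1, hrx]
  -- Follow `y` along a word for `g`. Here `p` is the point reached after the last irregular letter
  -- (or `y`), `d` collects the loops closed so far, and what remains is a regular germ from `p` to
  -- `φ g y`.
  have key : ∀ g : Γ, ∃ p ∈ Q, φ (t p) y = p ∧ ∃ d ∈ Subgroup.closure D,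
      Reg (g * d⁻¹ * (t p)⁻¹) p ∧ φ (g * d⁻¹ * (t p)⁻¹) p = φ g y := by
    intro g
    have hg : g ∈ Submonoid.closure S := by rw [hS]; trivial
    induction hg using Submonoid.closure_induction_left with
    | one =>
      refine ⟨y, hyQ, hty, (t y)⁻¹, ?_, ?_⟩
      · exact inv_mem (Subgroup.subset_closure ⟨Or.inl (Or.inl rfl), hty⟩)
      · simp only [inv_inv, one_mul, mul_inv_cancel]
        exact ⟨hone _ _ (one_mem _), trivial⟩
    | mul_left s hs g _ ih =>
      obtain ⟨p, hp, htp, d, hd, hreg, hgp⟩ := ih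
      have hdy : φ d y = y := hcl hd
      by_cases hr : Reg s (φ g y)
      · refine ⟨p, hp, htp, d, hd, ?_, ?_⟩
        · have := hcomp _ s _ hreg (by rwa [hgp])
          simpa only [mul_assoc] using this
        · rw [mul_assoc, mul_assoc, map_mul_apply, ← mul_assoc, hgp, map_mul_apply]
      · set x := φ g y with hx
        obtain ⟨hk1, hk2⟩ := hk p x ⟨_, hreg, hgp⟩
        have hsx : φ (t (φ s x)) y = φ s x := ht _ ⟨s * g, map_mul_apply φ s g y⟩
        have hmem : (t (φ s x))⁻¹ * s * k p x * t p ∈ D := by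
          refine ⟨Or.inr ⟨(s, x, p), ⟨hs, hQ1 s hs x hr, hp⟩, rfl⟩, ?_⟩
          change φ _ y = y
          rw [map_mul_apply, htp, map_mul_apply, hk2, map_mul_apply,
            map_inv_apply_eq_iff, hsx]
        have hdd : (t (φ s x))⁻¹ * s * k p x * t p * d ∈ Subgroup.closure D :=
          mul_mem (Subgroup.subset_closure hmem) hd
        have hgerm := conj_mem_germThrough (s := s)
          (quot_mem _ _ p x hreg hgp hk1 hk2)
        have heq : s * g * ((t (φ s x))⁻¹ * s * k p x * t p * d)⁻¹ * (t (φ s x))⁻¹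
            = s * (g * d⁻¹ * (t p)⁻¹ * (k p x)⁻¹) * s⁻¹ := by group
        refine ⟨φ s x, hQ2 s hs x hr, hsx, _, hdd, ?_, ?_⟩
        · rw [heq]
          exact hone _ _ hgerm
        · rw [heq, germThrough_le_stabThrough hgerm, map_mul_apply]
  intro g hg
  obtain ⟨p, hp, htp, d, hd, hreg, hgp⟩ := key g
  have hgy : φ g y = y := hg
  rw [hgy] at hgp
  obtain ⟨hk1, hk2⟩ := hk p y ⟨_, hreg, hgp⟩
  have hmem : k p y * t p ∈ D := by
    refine ⟨Or.inl (Or.inr ⟨p, hp, rfl⟩), ?_⟩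
    change φ _ y = y
    rw [map_mul_apply, htp, hk2]
  refine ⟨_, mul_mem (Subgroup.subset_closure hmem) hd, ?_⟩
  have := quot_mem _ _ p y hreg hgp hk1 hk2
  rwa [show g * (k p y * t p * d)⁻¹ = g * d⁻¹ * (t p)⁻¹ * (k p y)⁻¹ by group]

/-- With locally finite isotropy groups, the germ stabiliser has finite index in the stabiliser as
soon as the stabiliser is finitely generated modulo the germ stabiliser. -/
theorem relIndex_germThrough_of_locallyFinite {H : Subgroup (X ≃ₜ X)} (ρ : Γ →* H) (y : X)
    (hloc : IsLocallyFiniteGroup (IsotropyGroup H y)) {D : Set Γ} (hD : D.Finite)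
    (hDs : D ⊆ stabThrough (H.subtype.comp ρ) y)
    (hgen : ∀ g ∈ stabThrough (H.subtype.comp ρ) y, ∃ d ∈ Subgroup.closure D,
      g * d⁻¹ ∈ germThrough (H.subtype.comp ρ) y) :
    (germThrough (H.subtype.comp ρ) y).relIndex (stabThrough (H.subtype.comp ρ) y) ≠ 0 := by
  set φ := H.subtype.comp ρ
  have hcl : Subgroup.closure D ≤ stabThrough φ y := (Subgroup.closure_le _).mpr hDs
  let π : stabThrough φ y →* IsotropyGroup H y :=
    (QuotientGroup.mk' _).comp
      ((ρ.comp (stabThrough φ y).subtype).codRestrict (pointStabilizer H y) fun g => g.2)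
  have hπ : ∀ g : stabThrough φ y, π g = 1 ↔ (g : Γ) ∈ germThrough φ y := by
    intro g
    exact QuotientGroup.eq_one_iff _
  have hker : π.ker = (germThrough φ y).subgroupOf (stabThrough φ y) := by
    ext g
    rw [MonoidHom.mem_ker, hπ, Subgroup.mem_subgroupOf]
  have hrange : π.range = ((Subgroup.closure D).subgroupOf (stabThrough φ y)).map π := by
    apply le_antisymm
    · rintro _ ⟨g, rfl⟩
      obtain ⟨d, hd, hgd⟩ := hgen g g.2
      refine ⟨⟨d, hcl hd⟩, hd, ?_⟩
      have h := (hπ (g * ⟨d, hcl hd⟩⁻¹)).mpr hgd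
      rw [map_mul, map_inv, mul_inv_eq_one] at h
      exact h.symm
    · rintro _ ⟨g, _, rfl⟩
      exact ⟨g, rfl⟩
  have hfg : (Subgroup.closure D).FG := ⟨hD.toFinset, by rw [hD.coe_toFinset]⟩
  have hfin : Finite π.range := by
    refine hloc _ ?_
    rw [hrange]
    have h1 : Group.FG ((Subgroup.closure D).subgroupOf (stabThrough φ y)) := by
      have := (Group.fg_iff_subgroup_fg _).mpr hfg
      exact Group.fg_of_surjective
        (f := (Subgroup.subgroupOfEquivOfLe hcl).symm.toMonoidHom)
        (Subgroup.subgroupOfEquivOfLe hcl).symm.surjective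
    have h2 := Group.fg_of_surjective
      (π.subgroupMap_surjective ((Subgroup.closure D).subgroupOf (stabThrough φ y)))
    exact (Group.fg_iff_subgroup_fg _).mp h2
  have := Subgroup.finiteIndex_ker π
  rw [Subgroup.relIndex, ← hker]
  exact this.index_ne_zero

end RegularGerms

/-! ### Bounded type: regular germs and exhaustion of orbits -/

namespace BratteliDiagram

variable {B : BratteliDiagram}

theorem continuous_edge (i : ℕ) :
    @Continuous _ _ _ ⊥ (fun x : B.PathSpace => x.edge i) := by
  let : ∀ n, TopologicalSpace (B.E n) := fun _ => ⊥
  exact (continuous_apply i).comp continuous_induced_dom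

theorem eventually_edge_eq (x : B.PathSpace) (i : ℕ) : ∀ᶠ z in 𝓝 x, z.edge i = x.edge i := by
  let : ∀ n, TopologicalSpace (B.E n) := fun _ => ⊥
  have : ∀ n, DiscreteTopology (B.E n) := fun _ => ⟨rfl⟩
  exact (continuous_edge i).continuousAt.eventually (IsOpen.mem_nhds (isOpen_discrete {x.edge i}) rfl)

theorem eventually_edge_eq_le (x : B.PathSpace) (N : ℕ) :
    ∀ᶠ z in 𝓝 x, ∀ i ≤ N, z.edge i = x.edge i := by
  have h := (Filter.eventually_all_finite (Set.finite_Iic N)).mpr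
    fun i _ => eventually_edge_eq x i
  filter_upwards [h] with z hz i hi using hz i hi

/-- Near `x`, the homeomorphism `g` changes only a bounded number of initial edges. -/
def PreservesTailsAt (g : B.PathSpace ≃ₜ B.PathSpace) (x : B.PathSpace) : Prop :=
  ∃ N, ∀ᶠ z in 𝓝 x, ∀ i, N < i → (g z).edge i = z.edge i

theorem PreservesTailsAt.of_not_isSingularity {g : B.PathSpace ≃ₜ B.PathSpace} {x : B.PathSpace}
    (h : ¬ IsSingularity g x) : PreservesTailsAt g x := by
  obtain ⟨n, γ, η, hγη, hx, hg⟩ := not_not.mp h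
  refine ⟨n, ?_⟩
  filter_upwards [hg, eventually_edge_eq_le x n] with z hz hzx i hi
  rw [hz fun j hj => (hzx j hj).trans (hx j hj)]
  exact dif_neg (not_le.mpr hi)

variable {Γ : Type*} [Group Γ]

/-- The first `n + 1` edges of an infinite path. -/
def PathSpace.take (x : B.PathSpace) (n : ℕ) : B.FinPath n where
  edge i _ := x.edge i
  compat i _ := x.compat i

instance finite_finPath (n : ℕ) : Finite (B.FinPath n) := by
  have : ∀ i, Finite (B.E i) := B.finite_E
  refine Finite.of_injective (fun γ : B.FinPath n => fun i : Set.Iic n => γ.edge i i.2) ?_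
  intro γ η h
  ext i hi
  exact congrFun h ⟨i, hi⟩

/-- The paths that agree with `p` after the first `n + 1` edges. -/
def sameTail (n : ℕ) (p : B.PathSpace) : Set B.PathSpace := {z | ∀ i, n < i → z.edge i = p.edge i}

theorem sameTail_mono (p : B.PathSpace) : Monotone fun n => sameTail n p :=
  fun _ _ hmn _ hz i hi => hz i (hmn.trans_lt hi)

theorem injOn_take_sameTail (n : ℕ) (p : B.PathSpace) :
    Set.InjOn (fun z : B.PathSpace => z.take n) (sameTail n p) := by
  intro z hz w hw h
  ext i
  rcases le_or_gt i n with hi | hi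
  · exact congrFun (congrFun (congrArg FinPath.edge h) i) hi
  · rw [hz i hi, hw i hi]

theorem finite_sameTail (n : ℕ) (p : B.PathSpace) : (sameTail n p).Finite :=
  Set.Finite.of_injOn (Set.mapsTo_univ _ _) (injOn_take_sameTail n p) Set.finite_univ

/-- Paths with the tail of `p` are determined by their prefixes, which all end at the same vertex.
On a cylinder where `g` is a prefix replacement the tail is kept, so every exit is counted by the
activity at that vertex. -/
theorem encard_exit_sameTail_le (g : B.PathSpace ≃ₜ B.PathSpace) (n : ℕ) (p : B.PathSpace) :
    {z ∈ sameTail n p | g z ∉ sameTail n p}.encard ≤ activity g (p.take n).target := by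
  rw [← ((injOn_take_sameTail n p).mono (Set.sep_subset _ _)).encard_image]
  refine Set.encard_le_encard ?_
  rintro _ ⟨z, ⟨hz, hgz⟩, rfl⟩
  refine ⟨?_, ?_⟩
  · change B.tgt n (z.edge n) = B.tgt n (p.edge n)
    rw [z.compat, p.compat, hz _ n.lt_succ_self]
  · rintro ⟨η, h, hη⟩
    apply hgz
    intro i hi
    rw [hη ⟨z, fun _ _ => rfl⟩, ← hz i hi]
    exact dif_neg (not_le.mpr hi)

/-- A generator changes the tail class of a point only at one of its finitely many singularities.
The orbit of `y` thus lies in finitely many tail classes, and each class is exhausted by the finite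
sets `sameTail n p`. -/
theorem exists_exhaustion (φ : Γ →* (B.PathSpace ≃ₜ B.PathSpace))
    (hφ : ∀ g, IsBoundedType (φ g)) [hΓ : Group.FG Γ] (y : B.PathSpace) :
    ∃ F : ℕ → Set B.PathSpace, (∀ n, (F n).Finite) ∧ Monotone F ∧ (∀ g, ∃ n, φ g y ∈ F n) ∧
      ∀ g, ∃ C : ℕ, ∀ n, {z ∈ F n | φ g z ∉ F n}.encard ≤ C := by
  classical
  obtain ⟨S, hS, hSfin⟩ := Monoid.fg_iff.mp (Group.fg_iff_monoid_fg.mp hΓ)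
  -- Representatives of all tail classes met by the orbit: `y` itself, and the images of singular
  -- points under the generators.
  set Q : Set B.PathSpace := {y} ∪ ⋃ s ∈ S, φ s '' {x | IsSingularity (φ s) x} with hQ
  have hQfin : Q.Finite := (Set.finite_singleton y).union
    (hSfin.biUnion fun s _ => (hφ s).1.image _)
  refine ⟨fun n => ⋃ p ∈ Q, sameTail n p, fun n => hQfin.biUnion fun p _ => finite_sameTail n p,
    fun m n hmn => Set.biUnion_mono subset_rfl fun p _ => sameTail_mono p hmn, ?_, ?_⟩
  · intro g
    have hg : g ∈ Submonoid.closure S := by rw [hS]; trivial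
    induction hg using Submonoid.closure_induction_left with
    | one =>
      refine ⟨0, Set.mem_biUnion (x := y) (Or.inl rfl) fun i _ => ?_⟩
      rw [map_one_apply]
    | mul_left s hs g _ ih =>
      rw [map_mul_apply]
      by_cases hsing : IsSingularity (φ s) (φ g y)
      · exact ⟨0, Set.mem_biUnion (x := φ s (φ g y))
          (Or.inr (Set.mem_biUnion hs ⟨_, hsing, rfl⟩)) fun i _ => rfl⟩
      · obtain ⟨n, hn⟩ := ih
        obtain ⟨p, hp, hpn⟩ := Set.mem_iUnion₂.mp hn
        obtain ⟨N, hN⟩ := PreservesTailsAt.of_not_isSingularity hsing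
        refine ⟨max n N, Set.mem_biUnion hp fun i hi => ?_⟩
        rw [hN.self_of_nhds i (lt_of_le_of_lt (le_max_right _ _) hi),
          hpn i (lt_of_le_of_lt (le_max_left _ _) hi)]
  · intro g
    obtain ⟨C, hC⟩ := (hφ g).2
    refine ⟨hQfin.toFinset.card * C, fun n => ?_⟩
    have hsub : {z ∈ ⋃ p ∈ Q, sameTail n p | φ g z ∉ ⋃ p ∈ Q, sameTail n p} ⊆
        ⋃ p ∈ hQfin.toFinset, {z ∈ sameTail n p | φ g z ∉ sameTail n p} := by
      rintro z ⟨hz, hgz⟩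
      obtain ⟨p, hp, hpz⟩ := Set.mem_iUnion₂.mp hz
      exact Set.mem_biUnion (hQfin.mem_toFinset.mpr hp)
        ⟨hpz, fun h => hgz (Set.mem_biUnion hp h)⟩
    have hbound : ∀ P : Finset B.PathSpace,
        (⋃ p ∈ P, {z ∈ sameTail n p | φ g z ∉ sameTail n p}).encard ≤ P.card * C := by
      intro P
      induction P using Finset.induction_on with
      | empty => simp
      | insert p P hp ih =>
        rw [Finset.set_biUnion_insert, Finset.card_insert_of_notMem hp]
        refine (Set.encard_union_le _ _).trans ?_
        have h1 := (encard_exit_sameTail_le (φ g) n p).trans (hC n _)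
        refine (add_le_add h1 ih).trans (le_of_eq ?_)
        push_cast
        ring
    exact (Set.encard_le_encard hsub).trans ((hbound _).trans (by push_cast; exact le_rfl))

/-- The regular germs are those that preserve tails. They have no isotropy: a germ that fixes `x`
keeps, near `x`, the initial edges by continuity and the others by tail preservation. -/
theorem relIndex_germThrough {H : Subgroup (B.PathSpace ≃ₜ B.PathSpace)}
    (hH : IsStronglyBoundedType H) [Group.FG Γ] (ρ : Γ →* H) (y : B.PathSpace) :
    (germThrough (H.subtype.comp ρ) y).relIndex (stabThrough (H.subtype.comp ρ) y) ≠ 0 := by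
  set φ := H.subtype.comp ρ with hφ
  have hcont : ∀ (g : Γ) (x : B.PathSpace), Filter.Tendsto (φ g) (𝓝 x) (𝓝 (φ g x)) :=
    fun g x => (φ g).continuous.tendsto x
  suffices h : ∃ D : Set Γ, D.Finite ∧ D ⊆ stabThrough φ y ∧
      ∀ g ∈ stabThrough φ y, ∃ d ∈ Subgroup.closure D, g * d⁻¹ ∈ germThrough φ y by
    obtain ⟨D, hD, hDs, hgen⟩ := h
    exact relIndex_germThrough_of_locallyFinite ρ y (hH.2 y) hD hDs hgen
  refine exists_finite_generating_isotropy φ (fun g x => PreservesTailsAt (φ g) x)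
    ?_ ?_ ?_ ?_ ?_ y
  · rintro g h x ⟨N, hN⟩ ⟨M, hM⟩
    refine ⟨max N M, ?_⟩
    filter_upwards [hN, (hcont g x).eventually hM] with z hz1 hz2 i hi
    rw [map_mul_apply, hz2 i ((le_max_right _ _).trans_lt hi), hz1 i ((le_max_left _ _).trans_lt hi)]
  · rintro g x ⟨N, hN⟩
    refine ⟨N, ?_⟩
    have h := hcont g⁻¹ (φ g x)
    rw [map_inv_apply_self] at h
    filter_upwards [h.eventually hN] with z hz i hi
    rw [← hz i hi, map_apply_inv_self]
  · intro g x hg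
    refine ⟨0, ?_⟩
    filter_upwards [mem_germThrough.mp hg] with z hz i _
    rw [hz]
  · rintro g x ⟨N, hN⟩ hgx
    rw [mem_germThrough]
    filter_upwards [hN, (hcont g x).eventually (eventually_edge_eq_le _ N),
      eventually_edge_eq_le x N] with z hz1 hz2 hz3
    ext i
    rcases le_or_gt i N with hi | hi
    · rw [hz2 i hi, hgx, hz3 i hi]
    · exact hz1 i hi
  · intro g
    refine ((hH.1 (φ g) (ρ g).2).1).subset fun x hx => ?_
    by_contra h
    exact hx (PreservesTailsAt.of_not_isSingularity h)

end BratteliDiagram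

/-! ### Transfer from path spaces to the space X. -/

section Transfer

variable {X : Type*} [TopologicalSpace X] {Γ : Type*} [Group Γ]

theorem IsStronglyBoundedType.relIndex_germThrough {H : Subgroup (X ≃ₜ X)}
    (hH : IsStronglyBoundedType H) [Group.FG Γ] (ρ : Γ →* H) (y : X) :
    (germThrough (H.subtype.comp ρ) y).relIndex (stabThrough (H.subtype.comp ρ) y) ≠ 0 := by
  obtain ⟨B, f, hB⟩ := hH
  have h := BratteliDiagram.relIndex_germThrough hB (((homeoConj f).subgroupMap H).comp ρ) (f y)
  convert h using 2
  · ext g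
    rw [mem_germThrough, mem_germThrough, ← f.map_nhds_eq, Filter.eventually_map]
    refine Filter.eventually_congr (Filter.Eventually.of_forall fun z => ?_)
    change _ ↔ f ((ρ g : X ≃ₜ X) (f.symm (f z))) = f z
    rw [f.symm_apply_apply, f.injective.eq_iff]
    rfl
  · ext g
    change _ ↔ f ((ρ g : X ≃ₜ X) (f.symm (f y))) = f y
    rw [f.symm_apply_apply, f.injective.eq_iff]
    rfl

theorem IsStronglyBoundedType.exists_exhaustion {H : Subgroup (X ≃ₜ X)}
    (hH : IsStronglyBoundedType H) [Group.FG Γ] (ρ : Γ →* H) (y : X) :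
    ∃ F : ℕ → Set X, (∀ n, (F n).Finite) ∧ Monotone F ∧
      (∀ g, ∃ n, H.subtype.comp ρ g y ∈ F n) ∧
      ∀ g, ∃ C : ℕ, ∀ n, {z ∈ F n | H.subtype.comp ρ g z ∉ F n}.encard ≤ C := by
  obtain ⟨B, f, hB⟩ := hH
  set ψ : Γ →* (B.PathSpace ≃ₜ B.PathSpace) :=
    (H.map (homeoConj f)).subtype.comp (((homeoConj f).subgroupMap H).comp ρ) with hψ
  have hψf : ∀ g z, ψ g (f z) = f (H.subtype.comp ρ g z) := by
    intro g z
    change f ((ρ g : X ≃ₜ X) (f.symm (f z))) = _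
    rw [f.symm_apply_apply]
    rfl
  obtain ⟨F, hF, hmono, hcov, hbd⟩ := BratteliDiagram.exists_exhaustion ψ
    (fun g => hB.1 _ (((homeoConj f).subgroupMap H (ρ g)).2)) (f y)
  refine ⟨fun n => f ⁻¹' F n, fun n => (hF n).preimage f.injective.injOn,
    fun m n hmn => Set.preimage_mono (hmono hmn), ?_, ?_⟩
  · intro g
    obtain ⟨n, hn⟩ := hcov g
    rw [hψf] at hn
    exact ⟨n, hn⟩
  · intro g
    obtain ⟨C, hC⟩ := hbd g
    refine ⟨C, fun n => le_trans ?_ (hC n)⟩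
    rw [← f.injective.encard_image]
    refine Set.encard_le_encard ?_
    rintro _ ⟨z, ⟨hz1, hz2⟩, rfl⟩
    refine ⟨hz1, ?_⟩
    rw [hψf]
    exact hz2

end Transfer

/-! ### Finite orbits and commuting actions -/

section ProductActions

theorem map_relIndex_map_ne_zero {Γ Δ : Type*} [Group Γ] [Group Δ] (f : Γ →* Δ)
    {P K : Subgroup Γ} (hPK : P ≤ K) (h : P.relIndex K ≠ 0) :
    (P.map f).relIndex (K.map f) ≠ 0 := by
  refine ne_zero_of_dvd_ne_zero h ?_
  have h1 : (P.map f).subgroupOf (K.map f) = (P.subgroupOf K).map (f.subgroupMap K) := by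
    ext ⟨x, hx⟩
    constructor
    · rintro ⟨p, hp, hpx⟩
      exact ⟨⟨p, hPK hp⟩, hp, Subtype.ext hpx⟩
    · rintro ⟨p, hp, hpx⟩
      exact ⟨p, hp, congrArg Subtype.val hpx⟩
  rw [Subgroup.relIndex, h1]
  exact Subgroup.index_map_dvd _ (f.subgroupMap_surjective K)

variable {X : Type*} [TopologicalSpace X]

theorem stabThrough_index_ne_zero {Γ : Type*} [Group Γ] (φ : Γ →* (X ≃ₜ X)) {y : X}
    (h : (Set.range fun g => φ g y).Finite) : (stabThrough φ y).index ≠ 0 := by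
  have : Finite (Set.range fun g => φ g y) := h
  have : Finite (Γ ⧸ stabThrough φ y) := by
    refine Finite.of_injective
      (fun c => (⟨φ c.out y, c.out, rfl⟩ : Set.range fun g => φ g y)) fun c d hcd => ?_
    have hcd' : φ c.out y = φ d.out y := congrArg Subtype.val hcd
    rw [← QuotientGroup.out_eq' c, ← QuotientGroup.out_eq' d, QuotientGroup.eq,
      mem_stabThrough, map_mul_apply, map_inv_apply_eq_iff, hcd']
  exact Subgroup.index_ne_zero_of_finite

/-- The image of the germ stabiliser has finite index in the finitely generated group `Δ`, so it is
finitely generated. Lifts of finitely many generators are trivial on a common neighbourhood. The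
homomorphism `f` will be the identity or the projection of a product. -/
theorem exists_fixThrough_index_ne_zero {Γ Δ : Type*} [Group Γ] [Group Δ] [Group.FG Γ]
    [Group.FG Δ] {H : Subgroup (X ≃ₜ X)} (hH : IsStronglyBoundedType H) (ρ : Γ →* H) (y : X)
    (f : Γ →* Δ) (h : ((stabThrough (H.subtype.comp ρ) y).map f).index ≠ 0) :
    ∃ U ∈ 𝓝 y, ((fixThrough (H.subtype.comp ρ) U).map f).index ≠ 0 := by
  set φ := H.subtype.comp ρ
  have h1 : ((germThrough φ y).map f).relIndex ((stabThrough φ y).map f) ≠ 0 := by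
    exact map_relIndex_map_ne_zero f germThrough_le_stabThrough (hH.relIndex_germThrough ρ y)
  have h3 : ((germThrough φ y).map f).index ≠ 0 := by
    rw [← Subgroup.relIndex_top_right] at h ⊢
    exact Subgroup.relIndex_ne_zero_trans h1 h
  have : ((germThrough φ y).map f).FiniteIndex := ⟨h3⟩
  have hfg : ((germThrough φ y).map f).FG := (Group.fg_iff_subgroup_fg _).mp inferInstance
  obtain ⟨U, hU, hle⟩ := exists_le_map_fixThrough f hfg le_rfl
  exact ⟨U, hU, ne_zero_of_dvd_ne_zero h3 (Subgroup.index_dvd_of_le hle)⟩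

/-- If two finitely generated groups commute and the orbit of `y` under the first is infinite, then
finitely many orbits of the first cover the orbit of `y` under the product. -/
theorem map_snd_stabThrough_index_ne_zero {A B : Type*} [Group A] [Group B] [hA : Group.FG A]
    [Group.FG B] {H : Subgroup (X ≃ₜ X)} (hH : IsStronglyBoundedType H) (ρ : A × B →* H) (y : X)
    (hinf : (Set.range fun a : A => H.subtype.comp ρ (a, 1) y).Infinite) :
    ((stabThrough (H.subtype.comp ρ) y).map (MonoidHom.snd A B)).index ≠ 0 := by
  classical
  obtain ⟨F, hF, hmono, hcov, hbd⟩ := hH.exists_exhaustion ρ y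
  set φ := H.subtype.comp ρ with hφ
  set R := (stabThrough φ y).map (MonoidHom.snd A B) with hR
  intro h0
  have hQ : Infinite (B ⧸ R) := Subgroup.index_eq_zero_iff_infinite.mp h0
  obtain ⟨S, hS, hSfin⟩ := Monoid.fg_iff.mp (Group.fg_iff_monoid_fg.mp hA)
  choose C hC using hbd
  -- Cosets of `R` correspond to `A`-orbits in the orbit of `y`. One more is taken than there can be
  -- exit points from `F n` under the generators of `A`.
  obtain ⟨P, hP⟩ := Infinite.exists_subset_card_eq (B ⧸ R) (∑ s ∈ hSfin.toFinset, C (s, 1) + 1)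
  have hn : ∃ n, ∀ c ∈ P, φ (1, c.out) y ∈ F n := by
    choose m hm using hcov
    refine ⟨P.sup fun c => m (1, c.out), fun c hc => ?_⟩
    exact hmono (Finset.le_sup (f := fun c : B ⧸ R => m (1, c.out)) hc) (hm _)
  obtain ⟨n, hn⟩ := hn
  set E : Set X := ⋃ s ∈ hSfin.toFinset, {z ∈ F n | φ (s, 1) z ∉ F n} with hE
  have hEcard : E.encard ≤ (∑ s ∈ hSfin.toFinset, C (s, 1) : ℕ) := by
    have hbound : ∀ S' : Finset A, (⋃ s ∈ S', {z ∈ F n | φ (s, 1) z ∉ F n}).encard ≤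
        (∑ s ∈ S', C (s, 1) : ℕ) := by
      intro S'
      induction S' using Finset.induction_on with
      | empty => simp
      | insert s S' hs ih =>
        rw [Finset.set_biUnion_insert, Finset.sum_insert hs, Nat.cast_add]
        exact (Set.encard_union_le _ _).trans (add_le_add (hC _ n) ih)
    exact hbound _
  -- An infinite `A`-orbit that meets the finite set `F n` must leave it through a generator.
  have hexit : ∀ c ∈ P, ∃ a, φ (a, 1) (φ (1, c.out) y) ∈ E := by
    intro c hc
    by_contra! hno
    have hall : ∀ a, φ (a, 1) (φ (1, c.out) y) ∈ F n := by
      intro a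
      have ha : a ∈ Submonoid.closure S := by rw [hS]; trivial
      induction ha using Submonoid.closure_induction_left with
      | one =>
        rw [show ((1 : A), (1 : B)) = 1 from rfl, map_one_apply]
        exact hn c hc
      | mul_left s hs a _ ih =>
        by_contra hout
        refine hno a (Set.mem_biUnion (hSfin.mem_toFinset.mpr hs) ⟨ih, ?_⟩)
        rwa [← map_mul_apply, Prod.mk_mul_mk, one_mul]
    refine hinf (Set.Finite.subset ((hF n).preimage (φ (1, c.out)).injective.injOn) ?_)
    rintro _ ⟨a, rfl⟩
    have h := hall a
    rw [← map_mul_apply, Prod.mk_mul_mk, mul_one, one_mul] at h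
    change φ (1, c.out) (φ (a, 1) y) ∈ F n
    rwa [← map_mul_apply, Prod.mk_mul_mk, mul_one, one_mul]
  choose! a ha using hexit
  -- A common exit point of two `A`-orbits gives an element of the stabiliser of `y` whose second
  -- coordinate identifies the two cosets.
  have hinj : Set.InjOn (fun c : B ⧸ R => φ (a c, 1) (φ (1, c.out) y)) P := by
    intro c _ d _ hcd
    simp only [← map_mul_apply, Prod.mk_mul_mk, mul_one, one_mul] at hcd
    rw [← QuotientGroup.out_eq' c, ← QuotientGroup.out_eq' d, QuotientGroup.eq]
    refine ⟨(a c, c.out)⁻¹ * (a d, d.out), ?_, rfl⟩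
    change φ _ y = y
    rw [map_mul_apply, map_inv_apply_eq_iff, hcd]
  have h1 : ((P : Set (B ⧸ R)).encard) ≤ E.encard :=
    Set.encard_le_encard_of_injOn (f := fun c : B ⧸ R => φ (a c, 1) (φ (1, c.out) y))
      (fun c hc => ha c hc) hinj
  rw [Set.encard_coe_eq_coe_finsetCard, hP] at h1
  have h2 := h1.trans hEcard
  rw [Nat.cast_le] at h2
  omega

end ProductActions

/-! ### Commuting conjugates and commuting factors -/

section CommutingSubgroups

open scoped commutatorElement

/-- The finite group `A ⧸ S` has finitely many subgroups, so among enough conjugates of `B` three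
have the same image. For x, z in the first, take z' in the second with z' ≡ z and x' in the third
with x' ≡ x modulo `S`. As x commutes with z', and x' with z and z', the commutator ⁅x, z⁆ is
conjugate to ⁅x'⁻¹x, z'⁻¹z⁆, which lies in ⁅S, S⁆. -/
theorem commutator_le_of_commuting_conjugates_of_normal {A : Type*} [Group A] (S : Subgroup A)
    [S.Normal] [S.FiniteIndex] :
    ∃ N : ℕ, ∀ (B : Subgroup A) (a : Fin N → A),
      (∀ i j, i ≠ j → ∀ b ∈ B, ∀ c ∈ B, Commute (a i * b * (a i)⁻¹) (a j * c * (a j)⁻¹)) →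
      ⁅B, B⁆ ≤ ⁅S, S⁆ := by
  classical
  have : Fintype (Subgroup (A ⧸ S)) := Fintype.ofFinite _
  -- Pigeonhole with more than two conjugates for one image.
  refine ⟨Fintype.card (Subgroup (A ⧸ S)) * 2 + 1, fun B a hcomm => ?_⟩
  set M : Fin _ → Subgroup (A ⧸ S) := fun i =>
    (B.map (MulAut.conj (a i)).toMonoidHom).map (QuotientGroup.mk' S) with hM
  obtain ⟨K, hK⟩ := Fintype.exists_lt_card_fiber_of_mul_lt_card (f := M) (n := 2)
    (by rw [Fintype.card_fin]; exact Nat.lt_succ_self _)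
  obtain ⟨i, j, k, hi, hj, hk, hij, hik, hjk⟩ := Finset.two_lt_card_iff.mp hK
  rw [Finset.mem_filter_univ] at hi hj hk
  have lift : ∀ l, M l = K → ∀ b ∈ B, ∃ c ∈ B,
      (a l * c * (a l)⁻¹)⁻¹ * (a i * b * (a i)⁻¹) ∈ S := by
    intro l hl b hb
    have h1 : QuotientGroup.mk' S (a i * b * (a i)⁻¹) ∈ M l := by
      rw [hl, ← hi]
      exact ⟨_, ⟨b, hb, rfl⟩, rfl⟩
    obtain ⟨_, ⟨c, hc, rfl⟩, h2⟩ := h1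
    exact ⟨c, hc, QuotientGroup.eq.mp h2⟩
  rw [Subgroup.commutator_le]
  intro b hb c hc
  obtain ⟨c', hc', hβ⟩ := lift j hj c hc
  obtain ⟨b', hb', hα⟩ := lift k hk b hb
  have h1 := hcomm i j hij b hb c' hc'
  have h2 := hcomm k i hik.symm b' hb' c hc
  have h3 := hcomm k j hjk.symm b' hb' c' hc'
  have hconj : a i * ⁅b, c⁆ * (a i)⁻¹ = ⁅a i * b * (a i)⁻¹, a i * c * (a i)⁻¹⁆ := by
    simp only [commutatorElement_def]
    group
  suffices h : ⁅a i * b * (a i)⁻¹, a i * c * (a i)⁻¹⁆ ∈ ⁅S, S⁆ by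
    rw [← hconj] at h
    have h4 := (inferInstance : (⁅S, S⁆ : Subgroup A).Normal).conj_mem _ h (a i)⁻¹
    simpa only [mul_assoc, inv_mul_cancel_left, inv_inv, inv_mul_cancel, mul_one] using h4
  generalize a i * b * (a i)⁻¹ = x at *
  generalize a i * c * (a i)⁻¹ = z at *
  generalize a j * c' * (a j)⁻¹ = z' at *
  generalize a k * b' * (a k)⁻¹ = x' at *
  have h4 : Commute x' (z'⁻¹ * z) := h3.inv_right.mul_right h2
  have h5 : ⁅x, z⁆ = (z' * x') * ⁅x'⁻¹ * x, z'⁻¹ * z⁆ * (z' * x')⁻¹ := by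
    have e1 : x' * (z'⁻¹ * z) = (z'⁻¹ * z) * x' := h4.eq
    have e2 : x * z' = z' * x := h1.eq
    have e3 : x⁻¹ * x' * (z'⁻¹ * z)⁻¹ = x⁻¹ * ((z'⁻¹ * z)⁻¹ * x') := by
      rw [mul_assoc, h4.inv_right.eq]
    calc ⁅x, z⁆ = (x * z') * (z'⁻¹ * z) * x⁻¹ * (z'⁻¹ * z)⁻¹ * z'⁻¹ := by
          rw [commutatorElement_def]; group
      _ = z' * x * (z'⁻¹ * z) * (x⁻¹ * ((z'⁻¹ * z)⁻¹ * x')) * x'⁻¹ * z'⁻¹ := by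
          rw [e2]; group
      _ = z' * x * (z'⁻¹ * z) * (x⁻¹ * x' * (z'⁻¹ * z)⁻¹) * x'⁻¹ * z'⁻¹ := by rw [e3]
      _ = _ := by rw [commutatorElement_def]; group
  rw [h5]
  exact (inferInstance : (⁅S, S⁆ : Subgroup A).Normal).conj_mem _
    (Subgroup.commutator_mem_commutator hα hβ) _

/-- A subgroup with many pairwise commuting conjugates has its derived subgroup contained in the
derived subgroup of any given subgroup of finite index. -/
theorem commutator_le_of_commuting_conjugates {G : Type*} [Group G] {A S : Subgroup G}
    (hS : S.relIndex A ≠ 0) :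
    ∃ N : ℕ, ∀ B ≤ A, ∀ a : Fin N → G, (∀ i, a i ∈ A) →
      (∀ i j, i ≠ j → ∀ b ∈ B, ∀ c ∈ B, Commute (a i * b * (a i)⁻¹) (a j * c * (a j)⁻¹)) →
      ⁅B, B⁆ ≤ ⁅S, S⁆ := by
  have : (S.subgroupOf A).FiniteIndex := ⟨hS⟩
  obtain ⟨N, hN⟩ := commutator_le_of_commuting_conjugates_of_normal (S.subgroupOf A).normalCore
  refine ⟨N, fun B hB a ha hcomm => ?_⟩
  have h := hN (B.subgroupOf A) (fun i => ⟨a i, ha i⟩) fun i j hij b hb c hc =>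
    Subtype.ext (hcomm i j hij b hb c hc).eq
  have h1 := Subgroup.map_mono (f := A.subtype) (h.trans
    (Subgroup.commutator_mono (S.subgroupOf A).normalCore_le (S.subgroupOf A).normalCore_le))
  rw [Subgroup.map_commutator, Subgroup.map_commutator, Subgroup.subgroupOf_map_subtype,
    Subgroup.subgroupOf_map_subtype, inf_of_le_left hB] at h1
  exact h1.trans (Subgroup.commutator_mono inf_le_left inf_le_left)

variable {G : Type*} [Group G] {A C : Subgroup G}

theorem exists_mul_of_mem_sup_of_commute (hcomm : ∀ a ∈ A, ∀ c ∈ C, Commute a c) {g : G}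
    (hg : g ∈ A ⊔ C) : ∃ a ∈ A, ∃ c ∈ C, a * c = g := by
  have h := MonoidHom.noncommCoprod_range A.subtype C.subtype fun a c => hcomm a a.2 c c.2
  rw [A.range_subtype, C.range_subtype] at h
  rw [← h] at hg
  obtain ⟨⟨a, c⟩, hac⟩ := hg
  exact ⟨a, a.2, c, c.2, hac⟩

/-- A direct factor of a finitely generated group is finitely generated. -/
theorem fg_of_le_sup_of_commute (hcomm : ∀ a ∈ A, ∀ c ∈ C, Commute a c) (hdisj : Disjoint A C)
    {K : Subgroup G} (hK : K.FG) (hAK : A ≤ K) (hKs : K ≤ A ⊔ C) : A.FG := by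
  classical
  obtain ⟨S, rfl⟩ := hK
  have h : ∀ s ∈ S, ∃ a ∈ A, ∃ c ∈ C, a * c = s := fun s hs =>
    exists_mul_of_mem_sup_of_commute hcomm (hKs (Subgroup.subset_closure hs))
  choose! a ha c hc hac using h
  -- The `A`-components of the generators of `K` will generate `A`.
  have hle : Subgroup.closure (S.image a : Set G) ≤ A := by
    rw [Subgroup.closure_le]
    intro x hx
    obtain ⟨s, hs, rfl⟩ := Finset.mem_image.mp (Finset.mem_coe.mp hx)
    exact ha s hs
  refine ⟨S.image a, le_antisymm hle fun x hx => ?_⟩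
  have hx' : x ∈ Subgroup.closure (S.image a : Set G) ⊔ C := by
    refine (Subgroup.closure_le _).mpr ?_ (hAK hx)
    intro s hs
    rw [← hac s hs]
    exact mul_mem (Subgroup.mem_sup_left (Subgroup.subset_closure
      (Finset.mem_coe.mpr (Finset.mem_image_of_mem a hs)))) (Subgroup.mem_sup_right (hc s hs))
  obtain ⟨a₀, ha₀, c₀, hc₀, rfl⟩ :=
    exists_mul_of_mem_sup_of_commute (fun a ha c hc => hcomm a (hle ha) c hc) hx'
  have hcA : c₀ ∈ A := by
    have := mul_mem (inv_mem (hle ha₀)) hx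
    rwa [inv_mul_cancel_left] at this
  rwa [Subgroup.disjoint_def.mp hdisj hcA hc₀, mul_one]

theorem ncard_orbit_le_mul_relIndex {Ω : Type*} [MulAction G Ω] (A R : Subgroup G) (u : Ω)
    (hRA : R ≤ A) (hR : R.relIndex A ≠ 0) (hfin : (MulAction.orbit G u).Finite) :
    (MulAction.orbit A u).ncard ≤ (MulAction.orbit R u).ncard * R.relIndex A := by
  have horb : ∀ K : Subgroup G,
      (MulAction.orbit K u).ncard = (MulAction.stabilizer G u).relIndex K := fun K => by
    rw [← MulAction.index_stabilizer]
    rfl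
  have h1 := Subgroup.relIndex_inf_mul_relIndex (MulAction.stabilizer G u) R A
  rw [inf_of_le_left hRA] at h1
  rw [horb, horb, h1]
  -- Since `relIndex` is 0 for infinite index, divisibility gives the inequality only after the
  -- product is known to be non-zero; this uses that the orbit is finite.
  refine Nat.le_of_dvd ?_ (Subgroup.relIndex_dvd_of_le_left _ inf_le_left)
  rw [← h1]
  refine Nat.pos_of_ne_zero (mul_ne_zero ?_ hR)
  rw [← horb]
  exact Set.ncard_ne_zero_of_mem (MulAction.mem_orbit_self u)
    (hfin.subset (by rintro _ ⟨k, rfl⟩; exact ⟨(k : G), rfl⟩))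

end CommutingSubgroups

/-! ### Rooted trees and rigid stabilisers -/

section RootedTreeLemmas

variable {V : Type*} {T : SimpleGraph V} {o : V}

theorem isBelow_refl (v : V) : IsBelow T o v v := by
  simp [IsBelow]

theorem IsBelow.dist_le {v w : V} (h : IsBelow T o v w) : T.dist o v ≤ T.dist o w :=
  h ▸ Nat.le_add_right _ _

theorem IsBelow.trans (hT : T.IsTree) {u v w : V} (h1 : IsBelow T o u v) (h2 : IsBelow T o v w) :
    IsBelow T o u w := by
  have h3 := hT.connected.dist_triangle (u := u) (v := v) (w := w)
  have h4 := hT.connected.dist_triangle (u := o) (v := u) (w := w)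
  unfold IsBelow at *
  omega

theorem IsBelow.getVert_eq (hT : T.IsTree) {v w : V} (h : IsBelow T o v w) (p : T.Walk o w)
    (hp : p.IsPath) : p.getVert (T.dist o v) = v := by
  obtain ⟨q, hq⟩ := hT.connected.exists_walk_length_eq_dist o v
  obtain ⟨r, hr⟩ := hT.connected.exists_walk_length_eq_dist v w
  have h1 : (q.append r).IsPath := by
    apply SimpleGraph.Walk.isPath_of_length_eq_dist
    rw [SimpleGraph.Walk.length_append, hq, hr]
    exact h
  rw [(hT.existsUnique_path o w).unique hp h1, ← hq, SimpleGraph.Walk.getVert_append]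
  simp

theorem IsBelow.eq_of_dist_eq (hT : T.IsTree) {u v w : V} (h1 : IsBelow T o u w)
    (h2 : IsBelow T o v w) (h : T.dist o u = T.dist o v) : u = v := by
  obtain ⟨p, hp⟩ := (hT.existsUnique_path o w).exists
  rw [← h1.getVert_eq hT p hp, h, h2.getVert_eq hT p hp]

theorem exists_isBelow_of_le (hT : T.IsTree) {w : V} {n : ℕ} (hn : n ≤ T.dist o w) :
    ∃ u ∈ treeLevel T o n, IsBelow T o u w := by
  obtain ⟨p, hp⟩ := hT.connected.exists_walk_length_eq_dist o w
  have h1 := SimpleGraph.dist_le (p.take n)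
  have h2 := SimpleGraph.dist_le (p.drop n)
  have h3 := hT.connected.dist_triangle (u := o) (v := p.getVert n) (w := w)
  have h4 : (p.take n).length = n := by
    rw [SimpleGraph.Walk.take_length]
    omega
  have h5 : (p.drop n).length = T.dist o w - n := by
    rw [SimpleGraph.Walk.drop_length, hp]
  refine ⟨p.getVert n, ?_, ?_⟩
  · change T.dist o _ = n
    omega
  · unfold IsBelow
    omega

theorem IsBelow.of_dist_le (hT : T.IsTree) {u v w : V} (h1 : IsBelow T o u w)
    (h2 : IsBelow T o v w) (h : T.dist o u ≤ T.dist o v) : IsBelow T o u v := by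
  obtain ⟨u', hu', hu'v⟩ := exists_isBelow_of_le hT h
  rwa [h1.eq_of_dist_eq hT (hu'v.trans hT h2) (Eq.symm hu')]

theorem finite_treeLevel (hT : T.IsTree) (hfin : ∀ v, (T.neighborSet v).Finite) (n : ℕ) :
    (treeLevel T o n).Finite := by
  induction n with
  | zero =>
    refine (Set.finite_singleton o).subset fun v hv => ?_
    exact ((hT.connected.dist_eq_zero_iff).mp hv).symm
  | succ n ih =>
    refine (ih.biUnion fun v _ => hfin v).subset fun w hw => ?_
    have hw' : T.dist o w = n + 1 := hw
    obtain ⟨u, hu, huw⟩ := exists_isBelow_of_le hT (o := o) (n := n) (w := w) (by omega)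
    refine Set.mem_biUnion hu ?_
    rw [SimpleGraph.mem_neighborSet, ← SimpleGraph.dist_eq_one_iff_adj]
    have hu' : T.dist o u = n := hu
    unfold IsBelow at huw
    omega

theorem TreeBoundary.isBelow (hT : T.IsTree) (ξ : TreeBoundary T o) {n m : ℕ} (h : n ≤ m) :
    IsBelow T o (ξ.vertex n) (ξ.vertex m) := by
  induction m, h using Nat.le_induction with
  | base => exact isBelow_refl _
  | succ m _ ih =>
    refine ih.trans hT ?_
    unfold IsBelow
    rw [ξ.dist_root, ξ.dist_root, SimpleGraph.dist_eq_one_iff_adj.mpr (ξ.adj m)]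

variable {G : Subgroup (rootedAut T o)}

theorem dist_smul_root (g : G) (v : V) : T.dist o (g • v) = T.dist o v :=
  rootedAut_dist_root (g : rootedAut T o) v

theorem smul_mem_treeLevel (g : G) {v : V} {n : ℕ} (h : v ∈ treeLevel T o n) :
    g • v ∈ treeLevel T o n :=
  (dist_smul_root g v).trans h

theorem IsBelow.smul (g : G) {v w : V} (h : IsBelow T o v w) : IsBelow T o (g • v) (g • w) := by
  have h1 : T.dist (g • v) (g • w) = T.dist v w := rootedAut_dist (g : rootedAut T o) v w
  unfold IsBelow at *
  rw [dist_smul_root, dist_smul_root, h1, h]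

theorem eq_one_of_forall_smul_eq {g : G} (h : ∀ v : V, g • v = v) : g = 1 :=
  Subtype.ext (Subtype.ext (RelIso.ext h))

theorem IsBelow.smul_of_mem_ristVertex {g : G} {v w : V} (hg : g ∈ ristVertex G v)
    (h : IsBelow T o v w) : IsBelow T o v (g • w) := by
  by_contra hn
  have h1 := (ristVertex G v).inv_mem hg _ hn
  rw [inv_smul_smul] at h1
  exact hn (h1 ▸ h)

theorem ristVertex_mono (hT : T.IsTree) {v w : V} (h : IsBelow T o v w) :
    ristVertex G w ≤ ristVertex G v :=
  fun _ hg x hx => hg x fun hwx => hx (h.trans hT hwx)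

/-- The pointwise fixator of the subtree below `v`. -/
def subtreeFixator (G : Subgroup (rootedAut T o)) (v : V) : Subgroup G where
  carrier := {g | ∀ w, IsBelow T o v w → g • w = w}
  one_mem' _ _ := rfl
  mul_mem' := by
    intro a b ha hb w hw
    rw [mul_smul, hb w hw, ha w hw]
  inv_mem' := by
    intro a ha w hw
    rw [inv_smul_eq_iff, ha w hw]

theorem commute_of_mem_subtreeFixator {v : V} {a c : G} (ha : a ∈ ristVertex G v)
    (hc : c ∈ subtreeFixator G v) : Commute a c := by
  suffices h : ∀ x : V, (a * c) • x = (c * a) • x by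
    rw [commute_iff_eq, ← inv_mul_eq_one]
    refine eq_one_of_forall_smul_eq fun x => ?_
    rw [mul_smul, inv_smul_eq_iff, h]
  intro x
  rw [mul_smul, mul_smul]
  by_cases hx : IsBelow T o v x
  · rw [hc x hx, hc _ (hx.smul_of_mem_ristVertex ha)]
  · rw [ha x hx]
    refine ha _ fun h => hx ?_
    have h1 := (subtreeFixator G v).inv_mem hc _ h
    rw [inv_smul_smul] at h1
    exact h1 ▸ h

theorem disjoint_ristVertex_subtreeFixator (v : V) :
    Disjoint (ristVertex G v) (subtreeFixator G v) := by
  rw [Subgroup.disjoint_def]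
  intro g h1 h2
  refine eq_one_of_forall_smul_eq fun x => ?_
  by_cases hx : IsBelow T o v x
  · exact h2 x hx
  · exact h1 x hx

theorem ristVertex_le_subtreeFixator (hT : T.IsTree) {v w : V} (h : T.dist o v = T.dist o w)
    (hne : v ≠ w) : ristVertex G w ≤ subtreeFixator G v :=
  fun _ hg x hx => hg x fun hwx => hne (hx.eq_of_dist_eq hT hwx h)

theorem commute_of_mem_ristVertex (hT : T.IsTree) {v w : V} (h : T.dist o v = T.dist o w)
    (hne : v ≠ w) {a b : G} (ha : a ∈ ristVertex G v) (hb : b ∈ ristVertex G w) : Commute a b :=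
  commute_of_mem_subtreeFixator ha (ristVertex_le_subtreeFixator hT h hne hb)

theorem ristVertex_le_ristLevel {v : V} {n : ℕ} (hv : v ∈ treeLevel T o n) :
    ristVertex G v ≤ ristLevel G n :=
  le_iSup₂_of_le (f := fun v (_ : v ∈ treeLevel T o n) => ristVertex G v) v hv le_rfl

theorem ristLevel_le_sup (hT : T.IsTree) {v : V} {n : ℕ} (hv : v ∈ treeLevel T o n) :
    ristLevel G n ≤ ristVertex G v ⊔ subtreeFixator G v := by
  refine iSup₂_le fun w hw => ?_
  by_cases h : v = w
  · exact h ▸ le_sup_left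
  · exact (ristVertex_le_subtreeFixator hT (hv.trans (Eq.symm hw)) h).trans le_sup_right

/-- The rigid stabiliser of the level has finite index in a finitely generated group, and
`ristVertex G v` is a direct factor of it. -/
theorem fg_ristVertex (hT : T.IsTree) [Group.FG G] (hG : IsBranchGroup G) {v : V} {n : ℕ}
    (hn : 1 ≤ n) (hv : v ∈ treeLevel T o n) : (ristVertex G v).FG := by
  have := hG.2 n hn
  exact fg_of_le_sup_of_commute (fun a ha c hc => commute_of_mem_subtreeFixator ha hc)
    (disjoint_ristVertex_subtreeFixator v) ((Group.fg_iff_subgroup_fg (ristLevel G n)).mp inferInstance)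
    (ristVertex_le_ristLevel hv) (ristLevel_le_sup hT hv)

theorem ristLevel_anti (hT : T.IsTree) : Antitone (ristLevel G) := by
  intro n m hnm
  refine iSup₂_le fun w hw => ?_
  obtain ⟨u, hu, huw⟩ := exists_isBelow_of_le hT (w := w) (n := n) (hnm.trans_eq (Eq.symm hw))
  exact (ristVertex_mono hT huw).trans (ristVertex_le_ristLevel hu)

/-- The sizes of the levels tend to infinity. -/
def HasUnboundedLevels (T : SimpleGraph V) (o : V) : Prop :=
  ∀ N : ℕ, ∃ m₀, ∀ m, m₀ ≤ m → N ≤ (treeLevel T o m).ncard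

theorem orbit_eq_treeLevel (hG : IsLevelTransitive G) {u : V} {m : ℕ} (hu : u ∈ treeLevel T o m) :
    MulAction.orbit G u = treeLevel T o m := by
  ext w
  constructor
  · rintro ⟨g, rfl⟩
    exact smul_mem_treeLevel g hu
  · intro hw
    exact hG m u hu w hw

/-- Level `m` is a single `G`-orbit, so orbits of `ristLevel G n` on it have at least the proportion
1/k of its size. Below `v` these are orbits of `ristVertex G v`, and passing to `R` costs at most
the factor `l`. -/
theorem exists_le_ncard_orbit (hT : T.IsTree) (hfin : ∀ v, (T.neighborSet v).Finite)
    (hG : IsBranchGroup G) (hL : HasUnboundedLevels T o) {v : V} {n : ℕ} (hn : 1 ≤ n)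
    (hv : v ∈ treeLevel T o n) {R : Subgroup G} (hRv : R ≤ ristVertex G v)
    (hR : R.relIndex (ristVertex G v) ≠ 0) (N : ℕ) :
    ∃ m₀, ∀ m, m₀ ≤ m → ∀ u ∈ treeLevel T o m, IsBelow T o v u →
      N ≤ (MulAction.orbit R u).ncard := by
  set k := (ristLevel G n).index
  set l := R.relIndex (ristVertex G v)
  obtain ⟨m₀, hm₀⟩ := hL (N * l * k)
  refine ⟨m₀, fun m hm u hu hvu => ?_⟩
  have hk : k ≠ 0 := (hG.2 n hn).index_ne_zero
  have horb := orbit_eq_treeLevel hG.1 hu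
  have hofin : (MulAction.orbit G u).Finite := horb ▸ finite_treeLevel hT hfin m
  have h1 := ncard_orbit_le_mul_relIndex (ristVertex G v) R u hRv hR hofin
  have h2 := ncard_orbit_le_mul_relIndex ⊤ (ristLevel G n) u le_top
    (by rw [Subgroup.relIndex_top_right]; exact hk) hofin
  have h3 : MulAction.orbit (⊤ : Subgroup G) u = treeLevel T o m := by
    rw [← horb]
    ext w
    exact ⟨fun ⟨g, hg⟩ => ⟨g, hg⟩, fun ⟨g, hg⟩ => ⟨⟨g, trivial⟩, hg⟩⟩
  have h4 : MulAction.orbit (ristLevel G n) u = MulAction.orbit (ristVertex G v) u := by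
    ext w
    constructor
    · rintro ⟨⟨g, hg⟩, rfl⟩
      obtain ⟨a, ha, c, hc, rfl⟩ := exists_mul_of_mem_sup_of_commute
        (fun a ha c hc => commute_of_mem_subtreeFixator ha hc) (ristLevel_le_sup hT hv hg)
      refine ⟨⟨a, ha⟩, ?_⟩
      change a • u = (a * c) • u
      rw [mul_smul, hc u hvu]
    · rintro ⟨⟨g, hg⟩, rfl⟩
      exact ⟨⟨g, ristVertex_le_ristLevel hv hg⟩, rfl⟩
  rw [h3, h4, Subgroup.relIndex_top_right] at h2
  have h5 : N * l * k ≤ (MulAction.orbit R u).ncard * l * k :=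
    (hm₀ m hm).trans (h2.trans (Nat.mul_le_mul_right _ h1))
  exact Nat.le_of_mul_le_mul_right
    (Nat.le_of_mul_le_mul_right h5 (Nat.pos_of_ne_zero hk)) (Nat.pos_of_ne_zero hR)

theorem exists_injective_smul (hT : T.IsTree) (hfin : ∀ v, (T.neighborSet v).Finite)
    (hG : IsBranchGroup G) (hL : HasUnboundedLevels T o) {v : V} {n : ℕ} (hn : 1 ≤ n)
    (hv : v ∈ treeLevel T o n) {R : Subgroup G} (hRv : R ≤ ristVertex G v)
    (hR : R.relIndex (ristVertex G v) ≠ 0) (N : ℕ) :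
    ∃ m₀, ∀ m, m₀ ≤ m → ∀ u ∈ treeLevel T o m, IsBelow T o v u →
      ∃ a : Fin N → G, (∀ i, a i ∈ R) ∧ Function.Injective fun i => a i • u := by
  obtain ⟨m₀, hm₀⟩ := exists_le_ncard_orbit hT hfin hG hL hn hv hRv hR N
  refine ⟨m₀, fun m hm u hu hvu => ?_⟩
  have hfo : (MulAction.orbit R u).Finite := (finite_treeLevel hT hfin m).subset (by
    rintro _ ⟨k, rfl⟩
    exact smul_mem_treeLevel (k : G) hu)
  obtain ⟨P, hP, hcard⟩ := Set.exists_subset_card_eq (hm₀ m hm u hu hvu)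
  have : Finite P := hfo.subset hP
  let e : Fin N ≃ P := (Finite.equivFinOfCardEq hcard).symm
  have hr : ∀ i, ∃ r : R, r • u = e i := fun i => hP (e i).2
  choose r hr using hr
  refine ⟨fun i => r i, fun i => (r i).2, fun i j hij => ?_⟩
  apply e.injective
  apply Subtype.ext
  rw [← hr, ← hr]
  exact hij

theorem nonempty_treeLevel (hT : T.IsTree) (hL : HasUnboundedLevels T o) (m : ℕ) :
    (treeLevel T o m).Nonempty := by
  obtain ⟨m₀, hm₀⟩ := hL 1
  obtain ⟨w, hw⟩ := Set.nonempty_of_ncard_ne_zero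
    (Nat.one_le_iff_ne_zero.mp (hm₀ (max m m₀) (le_max_right _ _)))
  obtain ⟨u, hu, -⟩ := exists_isBelow_of_le hT ((le_max_left m m₀).trans_eq (Eq.symm hw))
  exact ⟨u, hu⟩

theorem exists_isBelow_treeLevel (hT : T.IsTree) (hG : IsLevelTransitive G) {n m : ℕ}
    (hnm : n ≤ m) {v : V} (hv : v ∈ treeLevel T o n) (hm : (treeLevel T o m).Nonempty) :
    ∃ u ∈ treeLevel T o m, IsBelow T o v u := by
  obtain ⟨w, hw⟩ := hm
  obtain ⟨v', hv', hv'w⟩ := exists_isBelow_of_le hT (hnm.trans_eq (Eq.symm hw))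
  obtain ⟨g, rfl⟩ := hG n v' hv' v hv
  exact ⟨g • w, smul_mem_treeLevel g hw, hv'w.smul g⟩

theorem exists_smul_ne_of_hasUnboundedLevels (hT : T.IsTree)
    (hfin : ∀ v, (T.neighborSet v).Finite) (hG : IsBranchGroup G) (hL : HasUnboundedLevels T o)
    {v : V} {n : ℕ} (hn : 1 ≤ n) (hv : v ∈ treeLevel T o n) :
    ∃ g ∈ ristVertex G v, ∃ m, n ≤ m ∧ ∃ u ∈ treeLevel T o m, IsBelow T o v u ∧ g • u ≠ u := by
  obtain ⟨m₀, hm₀⟩ := exists_injective_smul hT hfin hG hL hn hv le_rfl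
    (by rw [Subgroup.relIndex_self]; exact one_ne_zero) 2
  obtain ⟨u, hu, hvu⟩ := exists_isBelow_treeLevel hT hG.1 (le_max_left n m₀) hv
    (nonempty_treeLevel hT hL _)
  obtain ⟨a, ha, hinj⟩ := hm₀ _ (le_max_right n m₀) u hu hvu
  by_cases h : a 0 • u = u
  · refine ⟨a 1, ha 1, _, le_max_left n m₀, u, hu, hvu, fun h1 => ?_⟩
    exact zero_ne_one (hinj (h.trans h1.symm))
  · exact ⟨a 0, ha 0, _, le_max_left n m₀, u, hu, hvu, h⟩

/-- Take g in the rigid stabiliser of `v` moving some u below `v`, and h ≠ 1 in that of u. If they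
commuted, h would be supported below both u and g • u, hence trivial. -/
theorem commutator_ristLevel_ne_bot (hT : T.IsTree) (hfin : ∀ v, (T.neighborSet v).Finite)
    (hG : IsBranchGroup G) (hL : HasUnboundedLevels T o) {n : ℕ} (hn : 1 ≤ n) :
    ⁅ristLevel G n, ristLevel G n⁆ ≠ ⊥ := by
  obtain ⟨v, hv⟩ := nonempty_treeLevel hT hL n
  obtain ⟨g, hg, m, hm, u, hu, hvu, hgu⟩ :=
    exists_smul_ne_of_hasUnboundedLevels hT hfin hG hL hn hv
  obtain ⟨h, hh, -, -, x, -, -, hx⟩ :=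
    exists_smul_ne_of_hasUnboundedLevels hT hfin hG hL (hn.trans hm) hu
  have hle := ristVertex_le_ristLevel (G := G) hv
  intro hbot
  rw [Subgroup.commutator_eq_bot_iff_le_centralizer] at hbot
  have hcomm : h * g = g * h := hbot (hle hg) h (hle (ristVertex_mono hT hvu hh))
  have h1 : h ∈ ristVertex G (g • u) := by
    have h2 := ristVertex_conj G g u hh
    rwa [← hcomm, mul_inv_cancel_right] at h2
  have h3 : h = 1 := Subgroup.disjoint_def.mp (disjoint_ristVertex_subtreeFixator u) hh
    (ristVertex_le_subtreeFixator hT (dist_smul_root g u).symm (Ne.symm hgu) h1)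
  rw [h3, one_smul] at hx
  exact hx rfl

theorem hasUnboundedLevels_of_infinite (hT : T.IsTree) (hfin : ∀ v, (T.neighborSet v).Finite)
    [Infinite (TreeBoundary T o)] : HasUnboundedLevels T o := by
  classical
  intro N
  obtain ⟨P, hP⟩ := Infinite.exists_subset_card_eq (TreeBoundary T o) N
  have hsep : ∀ ξ η : TreeBoundary T o, ξ ≠ η → ∃ k, ξ.vertex k ≠ η.vertex k := by
    intro ξ η hne
    by_contra! h
    exact hne (TreeBoundary.ext (funext h))
  choose! k hk using hsep
  refine ⟨(P ×ˢ P).sup fun p => k p.1 p.2, fun m hm => ?_⟩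
  have hinj : Set.InjOn (fun ξ : TreeBoundary T o => ξ.vertex m) P := by
    intro ξ hξ η hη heq
    by_contra hne
    have hkm : k ξ η ≤ m := le_trans
      (Finset.le_sup (f := fun p : TreeBoundary T o × TreeBoundary T o => k p.1 p.2)
        (Finset.mk_mem_product hξ hη)) hm
    refine hk ξ η hne ?_
    have h1 := ξ.isBelow hT hkm
    rw [show ξ.vertex m = η.vertex m from heq] at h1
    exact h1.eq_of_dist_eq hT (η.isBelow hT hkm) ((ξ.dist_root _).trans (η.dist_root _).symm)
  rw [← hP, ← Set.ncard_coe_finset, ← hinj.ncard_image]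
  refine Set.ncard_le_ncard ?_ (finite_treeLevel hT hfin m)
  rintro _ ⟨ξ, -, rfl⟩
  exact ξ.dist_root m

/-- By transitivity, level sizes do not decrease as long as levels are non-empty. Once a bounded
sequence of sizes has reached its maximum there is no branching, so no automorphism can move
vertices only within one subtree. -/
theorem exists_ristLevel_eq_bot (hT : T.IsTree) (hfin : ∀ v, (T.neighborSet v).Finite)
    (hG : IsLevelTransitive G) (hL : ¬ HasUnboundedLevels T o) :
    ∃ n, 1 ≤ n ∧ ristLevel G n = ⊥ := by
  by_cases hne : ∀ m, (treeLevel T o m).Nonempty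
  swap
  · push Not at hne
    obtain ⟨n, hn⟩ := hne
    refine ⟨n + 1, by omega, eq_bot_iff.mpr (iSup₂_le fun w hw => ?_)⟩
    obtain ⟨u, hu, -⟩ := exists_isBelow_of_le hT (n := n) ((Nat.le_succ n).trans_eq (Eq.symm hw))
    rw [hn] at hu
    exact hu.elim
  have hdesc : ∀ n m, n ≤ m → ∃ d : V → V, Set.MapsTo d (treeLevel T o n) (treeLevel T o m) ∧
      ∀ v ∈ treeLevel T o n, IsBelow T o v (d v) := by
    intro n m hnm
    choose! d hd using fun v (hv : v ∈ treeLevel T o n) =>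
      exists_isBelow_treeLevel hT hG hnm hv (hne m)
    exact ⟨d, fun v hv => (hd v hv).1, fun v hv => (hd v hv).2⟩
  have hinj : ∀ n (d : V → V), (∀ v ∈ treeLevel T o n, IsBelow T o v (d v)) →
      Set.InjOn d (treeLevel T o n) := by
    intro n d hd v hv w hw h
    have h1 := hd v hv
    rw [h] at h1
    exact h1.eq_of_dist_eq hT (hd w hw) (hv.trans (Eq.symm hw))
  have hmono : Monotone fun n => (treeLevel T o n).ncard := by
    intro n m hnm
    obtain ⟨d, hd1, hd2⟩ := hdesc n m hnm
    exact Set.ncard_le_ncard_of_injOn d hd1 (hinj n d hd2) (finite_treeLevel hT hfin m)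
  simp only [HasUnboundedLevels, not_forall, not_exists, not_le] at hL
  obtain ⟨N, hN⟩ := hL
  have hbdd : BddAbove (Set.range fun n => (treeLevel T o n).ncard) := by
    refine ⟨N, ?_⟩
    rintro _ ⟨n, rfl⟩
    obtain ⟨m, hnm, hm⟩ := hN n
    exact (hmono hnm).trans hm.le
  obtain ⟨n, hn⟩ := Nat.sSup_mem (Set.range_nonempty _) hbdd
  refine ⟨n + 1, by omega, eq_bot_iff.mpr (iSup₂_le fun v hv g hg => ?_)⟩
  refine eq_one_of_forall_smul_eq fun x => ?_
  by_cases hvx : IsBelow T o v x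
  swap
  · exact hg x hvx
  have hnm : n + 1 ≤ T.dist o x := (Eq.symm hv).trans_le hvx.dist_le
  obtain ⟨d, hd1, hd2⟩ := hdesc _ _ hnm
  -- Maximality makes the injective choice of descendants a bijection, so every vertex of this level
  -- is the chosen descendant of some vertex of level `n + 1`.
  have himg : d '' treeLevel T o (n + 1) = treeLevel T o (T.dist o x) := by
    refine Set.eq_of_subset_of_ncard_le hd1.image_subset ?_ (finite_treeLevel hT hfin _)
    rw [(hinj _ d hd2).ncard_image]
    calc (treeLevel T o (T.dist o x)).ncard ≤ _ := le_csSup hbdd ⟨_, rfl⟩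
      _ = (treeLevel T o n).ncard := hn.symm
      _ ≤ _ := hmono (Nat.le_succ n)
  have huniq : ∀ z ∈ treeLevel T o (T.dist o x), IsBelow T o v z → z = d v := by
    intro z hz hvz
    rw [← himg] at hz
    obtain ⟨w, hw, rfl⟩ := hz
    rw [hvz.eq_of_dist_eq hT (hd2 w hw) (hv.trans (Eq.symm hw))]
  rw [huniq x rfl hvx]
  have := huniq (g • x) (dist_smul_root g x) (hvx.smul_of_mem_ristVertex hg)
  rwa [huniq x rfl hvx] at this

end RootedTreeLemmas

/-! ### Vertices whose rigid stabilisers accumulate at a point -/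

section CommutatorSup

theorem commutator_le_iff_le_comap_centralizer {G : Type*} [Group G] {A B N : Subgroup G}
    [N.Normal] : ⁅A, B⁆ ≤ N ↔ A ≤ (Subgroup.centralizer
      (B.map (QuotientGroup.mk' N) : Set (G ⧸ N))).comap (QuotientGroup.mk' N) := by
  rw [← Subgroup.map_le_iff_le_comap, ← Subgroup.commutator_eq_bot_iff_le_centralizer,
    ← Subgroup.map_commutator, Subgroup.map_eq_bot_iff, QuotientGroup.ker_mk']

/-- Modulo `N`, centralisers are subgroups, so commutation can be tested on generators in each
argument in turn. -/
theorem commutator_biSup_le {G ι : Type*} [Group G] {s : Set ι} {R : ι → Subgroup G}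
    {N : Subgroup G} [N.Normal] (h : ∀ i ∈ s, ∀ j ∈ s, ⁅R i, R j⁆ ≤ N) :
    ⁅⨆ i ∈ s, R i, ⨆ i ∈ s, R i⁆ ≤ N := by
  rw [commutator_le_iff_le_comap_centralizer]
  refine iSup₂_le fun i hi => ?_
  rw [← commutator_le_iff_le_comap_centralizer, Subgroup.commutator_comm,
    commutator_le_iff_le_comap_centralizer]
  refine iSup₂_le fun j hj => ?_
  rw [← commutator_le_iff_le_comap_centralizer]
  exact h j hj i hi

end CommutatorSup

section Accumulation

open scoped commutatorElement

variable {V : Type*} {T : SimpleGraph V} {o : V} {G : Subgroup (rootedAut T o)}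
  {X : Type*} [TopologicalSpace X]

theorem notMem_actionSupport_iff {Γ : Type*} [Group Γ] {φ : Γ →* (X ≃ₜ X)} {K : Subgroup Γ}
    {y : X} : y ∉ actionSupport φ K ↔ ∃ U ∈ 𝓝 y, K ≤ fixThrough φ U := by
  unfold actionSupport
  rw [← Set.mem_compl_iff, ← interior_compl, mem_interior_iff_mem_nhds]
  constructor
  · intro h
    exact ⟨_, h, fun k hk => mem_fixThrough.mpr fun z hz => not_not.mp hz k hk⟩
  · rintro ⟨U, hU, hK⟩
    filter_upwards [hU] with z hz h
    exact h fun k hk => mem_fixThrough.mp (hK hk) z hz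

theorem actionSupport_mono {Γ : Type*} [Group Γ] (φ : Γ →* (X ≃ₜ X)) {K L : Subgroup Γ}
    (h : K ≤ L) : actionSupport φ K ⊆ actionSupport φ L :=
  closure_mono fun _ hx hL => hx fun k hk => hL k (h hk)

theorem isClosed_actionSupport {Γ : Type*} [Group Γ] (φ : Γ →* (X ≃ₜ X)) (K : Subgroup Γ) :
    IsClosed (actionSupport φ K) :=
  isClosed_closure

/-- The derived rigid stabilisers of vertices arbitrarily far below `v` act non-trivially near
`y`. -/
def AccumulatesAt (φ : G →* (X ≃ₜ X)) (v : V) (y : X) : Prop :=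
  ∀ m, T.dist o v ≤ m → ∃ u ∈ treeLevel T o m, IsBelow T o v u ∧
    y ∈ actionSupport φ ⁅ristVertex G u, ristVertex G u⁆

variable {φ : G →* (X ≃ₜ X)} {y : X}

theorem actionSupport_ristVertex_mono (hT : T.IsTree) {u w : V} (h : IsBelow T o u w) :
    actionSupport φ ⁅ristVertex G w, ristVertex G w⁆ ⊆
      actionSupport φ ⁅ristVertex G u, ristVertex G u⁆ :=
  actionSupport_mono φ (Subgroup.commutator_mono (ristVertex_mono hT h) (ristVertex_mono hT h))

theorem mem_actionSupport_smul (g : G) (u : V)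
    (h : y ∈ actionSupport φ ⁅ristVertex G u, ristVertex G u⁆) :
    φ g y ∈ actionSupport φ ⁅ristVertex G (g • u), ristVertex G (g • u)⁆ := by
  have hconj : (ristVertex G u).map (MulAut.conj g).toMonoidHom ≤ ristVertex G (g • u) := by
    rintro _ ⟨k, hk, rfl⟩
    exact ristVertex_conj G g u hk
  have h1 : φ g y ∈ φ g '' actionSupport φ ⁅ristVertex G u, ristVertex G u⁆ := ⟨y, h, rfl⟩
  unfold actionSupport at h1 ⊢
  rw [(φ g).image_closure] at h1
  refine closure_mono ?_ h1
  rintro _ ⟨z, hz, rfl⟩ hfix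
  apply hz
  intro k hk
  have h2 : g * k * g⁻¹ ∈ ⁅ristVertex G (g • u), ristVertex G (g • u)⁆ := by
    refine Subgroup.commutator_mono hconj hconj ?_
    rw [← Subgroup.map_commutator]
    exact ⟨k, hk, rfl⟩
  have h3 := hfix _ h2
  rw [map_mul_apply, map_mul_apply, map_inv_apply_self] at h3
  exact (φ g).injective h3

theorem AccumulatesAt.smul (g : G) {v : V} (h : AccumulatesAt φ v y) :
    AccumulatesAt φ (g • v) (φ g y) := by
  intro m hm
  rw [dist_smul_root] at hm
  obtain ⟨u, hu, hvu, hy⟩ := h m hm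
  exact ⟨g • u, smul_mem_treeLevel g hu, hvu.smul g, mem_actionSupport_smul g u hy⟩

theorem AccumulatesAt.of_isBelow (hT : T.IsTree) {v w : V} (hvw : IsBelow T o v w)
    (h : AccumulatesAt φ w y) : AccumulatesAt φ v y := by
  intro m hm
  rcases le_total (T.dist o w) m with hwm | hwm
  · obtain ⟨u, hu, hwu, hy⟩ := h m hwm
    exact ⟨u, hu, hvw.trans hT hwu, hy⟩
  · obtain ⟨u, hu, huw⟩ := exists_isBelow_of_le hT hwm
    obtain ⟨x, -, hwx, hy⟩ := h _ le_rfl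
    refine ⟨u, hu, hvw.of_dist_le hT huw (hm.trans_eq (Eq.symm hu)), ?_⟩
    exact actionSupport_ristVertex_mono hT (huw.trans hT hwx) hy

theorem isClosed_setOf_accumulatesAt (hT : T.IsTree) (hfin : ∀ v, (T.neighborSet v).Finite)
    (φ : G →* (X ≃ₜ X)) (v : V) : IsClosed {y | AccumulatesAt φ v y} := by
  have h : {y | AccumulatesAt φ v y} = ⋂ (m) (_ : T.dist o v ≤ m),
      ⋃ u ∈ {u ∈ treeLevel T o m | IsBelow T o v u},
        actionSupport φ ⁅ristVertex G u, ristVertex G u⁆ := by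
    ext y
    simp only [Set.mem_iInter, Set.mem_iUnion]
    constructor
    · intro h m hm
      obtain ⟨u, hu, hvu, hy⟩ := h m hm
      exact ⟨u, ⟨hu, hvu⟩, hy⟩
    · intro h m hm
      obtain ⟨u, ⟨hu, hvu⟩, hy⟩ := h m hm
      exact ⟨u, hu, hvu, hy⟩
  rw [h]
  refine isClosed_biInter fun m _ => Set.Finite.isClosed_biUnion ?_ fun u _ =>
    isClosed_actionSupport φ _
  exact (finite_treeLevel hT hfin m).subset (Set.sep_subset _ _)

/-- Supports grow towards the root, so failure below `v` at depth `m v` persists at all greater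
depths. If every vertex of the finite set `W` failed, the largest such depth would contradict `h`.
-/
theorem exists_accumulatesAt (hT : T.IsTree) {W : Set V} (hW : W.Finite)
    (h : ∀ m₀, ∃ m, m₀ ≤ m ∧ ∃ u ∈ treeLevel T o m, (∃ v ∈ W, IsBelow T o v u) ∧
      y ∈ actionSupport φ ⁅ristVertex G u, ristVertex G u⁆) :
    ∃ v ∈ W, AccumulatesAt φ v y := by
  by_contra! hno
  have hno' : ∀ v ∈ W, ∃ m, T.dist o v ≤ m ∧ ∀ u ∈ treeLevel T o m, IsBelow T o v u →
      y ∉ actionSupport φ ⁅ristVertex G u, ristVertex G u⁆ := by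
    intro v hv
    by_contra! hc
    exact hno v hv hc
  choose! m hm1 hm2 using hno'
  obtain ⟨k, hk, u, hu, ⟨v, hv, hvu⟩, hy⟩ := h (hW.toFinset.sup m)
  have hmk : m v ≤ k := (Finset.le_sup (hW.mem_toFinset.mpr hv)).trans hk
  obtain ⟨x, hx, hxu⟩ := exists_isBelow_of_le hT (hmk.trans_eq (Eq.symm hu))
  exact hm2 v hv x hx (hvu.of_dist_le hT hxu ((hm1 v hv).trans_eq (Eq.symm hx)))
    (actionSupport_ristVertex_mono hT hxu hy)

theorem AccumulatesAt.exists_below (hT : T.IsTree) (hfin : ∀ v, (T.neighborSet v).Finite) {v : V}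
    (h : AccumulatesAt φ v y) {m : ℕ} (hm : T.dist o v ≤ m) :
    ∃ u ∈ treeLevel T o m, IsBelow T o v u ∧ AccumulatesAt φ u y := by
  obtain ⟨u, ⟨hu, hvu⟩, hy⟩ := exists_accumulatesAt (φ := φ) (y := y) hT
    (W := {u ∈ treeLevel T o m | IsBelow T o v u})
    ((finite_treeLevel hT hfin m).subset (Set.sep_subset _ _)) fun m₀ => by
      obtain ⟨x, hx, hvx, hy⟩ := h (max m m₀) (hm.trans (le_max_left _ _))
      obtain ⟨u, hu, hux⟩ := exists_isBelow_of_le hT ((le_max_left m m₀).trans_eq (Eq.symm hx))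
      exact ⟨_, le_max_right _ _, x, hx,
        ⟨u, ⟨hu, hvx.of_dist_le hT hux (hm.trans_eq (Eq.symm hu))⟩, hux⟩, hy⟩
  exact ⟨u, hu, hvu, hy⟩

/-- Rigid stabilisers of distinct vertices of a level commute, so the derived subgroup of their join
lies in the join of their derived subgroups. If each of these is trivial near `y`, all are trivial
on a finite intersection of neighbourhoods. -/
theorem exists_mem_actionSupport_ristVertex (hT : T.IsTree)
    (hfin : ∀ v, (T.neighborSet v).Finite) {n : ℕ}
    (hy : y ∈ actionSupport φ ⁅ristLevel G n, ristLevel G n⁆) :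
    ∃ u ∈ treeLevel T o n, y ∈ actionSupport φ ⁅ristVertex G u, ristVertex G u⁆ := by
  by_contra! hno
  set N : Subgroup G := ⨆ u ∈ treeLevel T o n, ⁅ristVertex G u, ristVertex G u⁆ with hN
  have hle : ∀ u ∈ treeLevel T o n, ⁅ristVertex G u, ristVertex G u⁆ ≤ N := fun u hu =>
    le_iSup₂_of_le (f := fun u (_ : u ∈ treeLevel T o n) => ⁅ristVertex G u, ristVertex G u⁆)
      u hu le_rfl
  have hnormal : N.Normal := by
    constructor
    intro k hk g
    have h : N ≤ N.comap (MulAut.conj g).toMonoidHom := by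
      refine iSup₂_le fun u hu => ?_
      rw [← Subgroup.map_le_iff_le_comap, Subgroup.map_commutator]
      refine le_trans (Subgroup.commutator_mono ?_ ?_) (hle (g • u) (smul_mem_treeLevel g hu)) <;>
      · rintro _ ⟨k, hk, rfl⟩
        exact ristVertex_conj G g u hk
    exact h hk
  have h1 : ⁅ristLevel G n, ristLevel G n⁆ ≤ N := by
    refine commutator_biSup_le fun u hu w hw => ?_
    by_cases huw : u = w
    · exact huw ▸ hle u hu
    · rw [Subgroup.commutator_le]
      intro a ha b hb
      rw [commutatorElement_eq_one_iff_commute.mpr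
        (commute_of_mem_ristVertex hT (hu.trans (Eq.symm hw)) huw ha hb)]
      exact one_mem N
  have h2 : ∀ u ∈ treeLevel T o n, ∃ U ∈ 𝓝 y, ⁅ristVertex G u, ristVertex G u⁆ ≤ fixThrough φ U :=
    fun u hu => notMem_actionSupport_iff.mp (hno u hu)
  choose! U hU hfix using h2
  refine notMem_actionSupport_iff.mpr ⟨⋂ u ∈ treeLevel T o n, U u,
    (Filter.biInter_mem (finite_treeLevel hT hfin n)).mpr hU, h1.trans ?_⟩ hy
  exact iSup₂_le fun u hu => (hfix u hu).trans (fixThrough_anti (Set.biInter_subset_of_mem hu))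

theorem exists_accumulatesAt_of_mem_essentialSupport (hT : T.IsTree)
    (hfin : ∀ v, (T.neighborSet v).Finite) (hy : y ∈ essentialSupport G φ) (n : ℕ) :
    ∃ v ∈ treeLevel T o n, AccumulatesAt φ v y := by
  refine exists_accumulatesAt hT (finite_treeLevel hT hfin n) fun m₀ => ?_
  have hy' : y ∈ actionSupport φ ⁅ristLevel G (n + m₀ + 1), ristLevel G (n + m₀ + 1)⁆ :=
    Set.mem_iInter₂.mp hy _ (Nat.le_add_left _ _)
  obtain ⟨u, hu, hyu⟩ := exists_mem_actionSupport_ristVertex hT hfin hy'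
  obtain ⟨v, hv, hvu⟩ := exists_isBelow_of_le hT (n := n) (w := u) (by
    rw [show T.dist o u = n + m₀ + 1 from hu]; omega)
  exact ⟨n + m₀ + 1, by omega, u, hu, ⟨v, hv, hvu⟩, hyu⟩

/-- For `u` deep below `v`, the many translates of `u` under `ristVertex G v` have pairwise
commuting rigid stabilisers. Hence the derived rigid stabiliser of `u` lies in ⁅S, S⁆ and is trivial
near `y`. -/
theorem not_accumulatesAt_of_commutator_le (hT : T.IsTree)
    (hfin : ∀ v, (T.neighborSet v).Finite) (hG : IsBranchGroup G) (hL : HasUnboundedLevels T o)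
    {v : V} {n : ℕ} (hn : 1 ≤ n) (hv : v ∈ treeLevel T o n) {S : Subgroup G}
    (hS : S.relIndex (ristVertex G v) ≠ 0) {U : Set X} (hU : U ∈ 𝓝 y)
    (hSU : ⁅S, S⁆ ≤ fixThrough φ U) : ¬ AccumulatesAt φ v y := by
  intro hacc
  obtain ⟨N, hN⟩ := commutator_le_of_commuting_conjugates hS
  obtain ⟨m₀, hm₀⟩ := exists_injective_smul hT hfin hG hL hn hv le_rfl
    (by rw [Subgroup.relIndex_self]; exact one_ne_zero) N
  obtain ⟨u, hu, hvu, hy⟩ := hacc (max n m₀) ((le_of_eq hv).trans (le_max_left _ _))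
  obtain ⟨a, ha, hinj⟩ := hm₀ _ (le_max_right _ _) u hu hvu
  refine notMem_actionSupport_iff.mpr ⟨U, hU, le_trans ?_ hSU⟩ hy
  refine hN _ (ristVertex_mono hT hvu) a ha fun i j hij b hb c hc => ?_
  exact commute_of_mem_ristVertex hT ((dist_smul_root _ _).trans (dist_smul_root _ _).symm)
    (hinj.ne hij) (ristVertex_conj G _ u hb) (ristVertex_conj G _ u hc)

variable {H : Subgroup (X ≃ₜ X)} {ρ : G →* H}

/-- If the orbit were finite, the stabiliser of `y`, and then the fixator of a neighbourhood of `y`,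
would have finite index in `ristVertex G v`, against `not_accumulatesAt_of_commutator_le`. -/
theorem AccumulatesAt.infinite_orbit (hT : T.IsTree) (hfin : ∀ v, (T.neighborSet v).Finite)
    [Group.FG G] (hG : IsBranchGroup G) (hL : HasUnboundedLevels T o)
    (hH : IsStronglyBoundedType H) {v : V} {n : ℕ} (hn : 1 ≤ n) (hv : v ∈ treeLevel T o n)
    (h : AccumulatesAt (H.subtype.comp ρ) v y) :
    (Set.range fun a : ristVertex G v => H.subtype.comp ρ a y).Infinite := by
  intro hfinite
  have : Group.FG (ristVertex G v) := (Group.fg_iff_subgroup_fg _).mpr (fg_ristVertex hT hG hn hv)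
  set ρ' := ρ.comp (ristVertex G v).subtype with hρ'
  have h1 : (stabThrough (H.subtype.comp ρ') y).index ≠ 0 := stabThrough_index_ne_zero _ hfinite
  rw [← Subgroup.map_id (stabThrough (H.subtype.comp ρ') y)] at h1
  obtain ⟨U, hU, h2⟩ := exists_fixThrough_index_ne_zero hH ρ' y (MonoidHom.id _) h1
  rw [Subgroup.map_id] at h2
  refine not_accumulatesAt_of_commutator_le hT hfin hG hL hn hv
    (S := fixThrough (H.subtype.comp ρ) U) ?_ hU (Subgroup.commutator_le_self _) h
  have h3 : (fixThrough (H.subtype.comp ρ) U).subgroupOf (ristVertex G v) =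
      fixThrough (H.subtype.comp ρ') U := by
    ext g
    rw [Subgroup.mem_subgroupOf, mem_fixThrough, mem_fixThrough]
    rfl
  rwa [Subgroup.relIndex, h3]

/-- The product of the two commuting rigid stabilisers acts, and its first factor has an infinite
orbit at `y`. The stabiliser of `y`, then the fixator of some `U`, therefore projects onto a
finite-index subgroup `R` of the second factor. -/
theorem AccumulatesAt.exists_commensurate (hT : T.IsTree) (hfin : ∀ v, (T.neighborSet v).Finite)
    [Group.FG G] (hG : IsBranchGroup G) (hL : HasUnboundedLevels T o)
    (hH : IsStronglyBoundedType H) {v w : V} {n : ℕ} (hn : 1 ≤ n) (hv : v ∈ treeLevel T o n)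
    (hw : w ∈ treeLevel T o n) (hvw : v ≠ w) (h : AccumulatesAt (H.subtype.comp ρ) v y) :
    ∃ U ∈ 𝓝 y, ∃ R ≤ ristVertex G w, R.relIndex (ristVertex G w) ≠ 0 ∧
      ∀ b ∈ R, ∃ a ∈ ristVertex G v, a * b ∈ fixThrough (H.subtype.comp ρ) U := by
  have hinf := h.infinite_orbit hT hfin hG hL hH hn hv
  have : Group.FG (ristVertex G v) := (Group.fg_iff_subgroup_fg _).mpr (fg_ristVertex hT hG hn hv)
  have : Group.FG (ristVertex G w) := (Group.fg_iff_subgroup_fg _).mpr (fg_ristVertex hT hG hn hw)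
  let κ : ristVertex G v × ristVertex G w →* G :=
    MonoidHom.noncommCoprod (ristVertex G v).subtype (ristVertex G w).subtype fun a b =>
      commute_of_mem_ristVertex hT (hv.trans (Eq.symm hw)) hvw a.2 b.2
  have hκ : ∀ a b, κ (a, b) = (a : G) * b := fun a b => rfl
  have h1 := map_snd_stabThrough_index_ne_zero hH (ρ.comp κ) y (by
    convert hinf using 3 with a
    change H.subtype.comp ρ (κ (a, 1)) y = _
    rw [hκ]
    simp)
  obtain ⟨U, hU, h2⟩ := exists_fixThrough_index_ne_zero hH (ρ.comp κ) y _ h1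
  refine ⟨U, hU, ((fixThrough (H.subtype.comp (ρ.comp κ)) U).map (MonoidHom.snd _ _)).map
    (ristVertex G w).subtype, Subgroup.map_subtype_le _, ?_, ?_⟩
  · rwa [Subgroup.relIndex, Subgroup.subgroupOf,
      Subgroup.comap_map_eq_self_of_injective (ristVertex G w).subtype_injective]
  · rintro _ ⟨_, ⟨⟨a, b⟩, hab, rfl⟩, rfl⟩
    exact ⟨a, a.2, mem_fixThrough.mpr fun z hz => mem_fixThrough.mp hab z hz⟩

/-- Elements b, c of a finite-index subgroup of `ristVertex G u` become trivial near `y` after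
correction by a below `v` and by d below `w`. All other pairs commute, so ⁅b, c⁆ = ⁅ab, dc⁆ is
trivial near `y`. -/
theorem not_three_accumulatesAt (hT : T.IsTree) (hfin : ∀ v, (T.neighborSet v).Finite)
    [Group.FG G] (hG : IsBranchGroup G) (hL : HasUnboundedLevels T o)
    (hH : IsStronglyBoundedType H) {u v w : V} {n : ℕ} (hn : 1 ≤ n) (hu : u ∈ treeLevel T o n)
    (hv : v ∈ treeLevel T o n) (hw : w ∈ treeLevel T o n) (huv : u ≠ v) (huw : u ≠ w)
    (hvw : v ≠ w) (hau : AccumulatesAt (H.subtype.comp ρ) u y)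
    (hav : AccumulatesAt (H.subtype.comp ρ) v y) (haw : AccumulatesAt (H.subtype.comp ρ) w y) :
    False := by
  obtain ⟨U₁, hU₁, R₁, hR₁, hR₁i, hR₁f⟩ :=
    hav.exists_commensurate hT hfin hG hL hH hn hv hu huv.symm
  obtain ⟨U₂, hU₂, R₂, hR₂, hR₂i, hR₂f⟩ :=
    haw.exists_commensurate hT hfin hG hL hH hn hw hu huw.symm
  refine not_accumulatesAt_of_commutator_le hT hfin hG hL hn hu (S := R₁ ⊓ R₂)
    (Subgroup.relIndex_inf_ne_zero hR₁i hR₂i) (Filter.inter_mem hU₁ hU₂) ?_ hau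
  rw [Subgroup.commutator_le]
  intro b hb c hc
  obtain ⟨a, ha, hab⟩ := hR₁f b hb.1
  obtain ⟨d, hd, hdc⟩ := hR₂f c hc.2
  have e1 : Commute a b := commute_of_mem_ristVertex hT (hv.trans (Eq.symm hu)) huv.symm ha (hR₁ hb.1)
  have e2 : Commute a c := commute_of_mem_ristVertex hT (hv.trans (Eq.symm hu)) huv.symm ha (hR₁ hc.1)
  have e3 : Commute a d := commute_of_mem_ristVertex hT (hv.trans (Eq.symm hw)) hvw ha hd
  have e4 : Commute d b := commute_of_mem_ristVertex hT (hw.trans (Eq.symm hu)) huw.symm hd (hR₁ hb.1)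
  have e5 : Commute d c := commute_of_mem_ristVertex hT (hw.trans (Eq.symm hu)) huw.symm hd (hR₁ hc.1)
  have h1 : ⁅a * b, d * c⁆ = ⁅b, c⁆ := by
    have e6 : Commute a (b * (d * c) * b⁻¹) :=
      (e1.mul_right (e3.mul_right e2)).mul_right e1.inv_right
    have e7 : Commute d (b * c * b⁻¹) := (e4.mul_right e5).mul_right e4.inv_right
    calc ⁅a * b, d * c⁆ = a * (b * (d * c) * b⁻¹) * a⁻¹ * (d * c)⁻¹ := by
          rw [commutatorElement_def]; group
      _ = (b * d) * c * b⁻¹ * c⁻¹ * d⁻¹ := by rw [e6.eq]; group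
      _ = d * (b * c * b⁻¹) * c⁻¹ * d⁻¹ := by rw [← e4.eq]; group
      _ = (b * c * b⁻¹) * (d * c⁻¹) * d⁻¹ := by rw [e7.eq]; group
      _ = ⁅b, c⁆ := by rw [e5.inv_right.eq, commutatorElement_def]; group
  rw [← h1]
  have h2 := fixThrough_anti (φ := H.subtype.comp ρ) (Set.inter_subset_left (s := U₁) (t := U₂)) hab
  have h3 := fixThrough_anti (φ := H.subtype.comp ρ) (Set.inter_subset_right (s := U₁) (t := U₂)) hdc
  exact Subgroup.commutator_le_self _ (Subgroup.commutator_mem_commutator h2 h3)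

/-- Two accumulating vertices `v` ≠ `w` would give three on a deeper level: two translates under `R`
of a vertex below `v`, and one vertex below `w`. -/
theorem AccumulatesAt.eq_of_mem_treeLevel (hT : T.IsTree) (hfin : ∀ v, (T.neighborSet v).Finite)
    [Group.FG G] (hG : IsBranchGroup G) (hL : HasUnboundedLevels T o)
    (hH : IsStronglyBoundedType H) {v w : V} {n : ℕ} (hv : v ∈ treeLevel T o n)
    (hw : w ∈ treeLevel T o n) (hav : AccumulatesAt (H.subtype.comp ρ) v y)
    (haw : AccumulatesAt (H.subtype.comp ρ) w y) : v = w := by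
  rcases Nat.eq_zero_or_pos n with rfl | hn
  · rw [← hT.connected.dist_eq_zero_iff.mp hv, ← hT.connected.dist_eq_zero_iff.mp hw]
  by_contra hvw
  obtain ⟨U, hU, R, hR, hRi, hRf⟩ :=
    haw.exists_commensurate hT hfin hG hL hH hn hw hv (Ne.symm hvw)
  obtain ⟨m₀, hm₀⟩ := exists_injective_smul hT hfin hG hL hn hv hR hRi 2
  obtain ⟨u, hu, hvu, hau⟩ := hav.exists_below hT hfin (m := max n m₀)
    ((le_of_eq hv).trans (le_max_left _ _))
  obtain ⟨x, hx, hwx, hax⟩ := haw.exists_below hT hfin (m := max n m₀)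
    ((le_of_eq hw).trans (le_max_left _ _))
  obtain ⟨a, ha, hinj⟩ := hm₀ _ (le_max_right _ _) u hu hvu
  have hbelow : ∀ i, IsBelow T o v (a i • u) := fun i =>
    hvu.smul_of_mem_ristVertex (hR (ha i))
  have hdist : T.dist o v = T.dist o w := hv.trans (Eq.symm hw)
  -- The corrected element `c * a i` fixes `y`, and `c` acts trivially below `v`, so it carries
  -- accumulation from `u` to `a i • u` at the same point `y`.
  have hacc : ∀ i, AccumulatesAt (H.subtype.comp ρ) (a i • u) y := by
    intro i
    obtain ⟨c, hc, hca⟩ := hRf (a i) (ha i)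
    have h1 := hau.smul (c * a i)
    rwa [mem_fixThrough.mp hca y (mem_of_mem_nhds hU), mul_smul,
      ristVertex_le_subtreeFixator hT hdist hvw hc _ (hbelow i)] at h1
  have hne : ∀ i, a i • u ≠ x := fun i h =>
    hvw ((hbelow i).eq_of_dist_eq hT (h ▸ hwx) hdist)
  exact not_three_accumulatesAt hT hfin hG hL hH (Nat.le_trans hn (le_max_left n m₀))
    (smul_mem_treeLevel (a 0) hu) (smul_mem_treeLevel (a 1) hu) hx
    (fun h => zero_ne_one (hinj h)) (hne 0) (hne 1) (hacc 0) (hacc 1) hax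

end Accumulation

/-! ### Non-emptiness of the essential support and construction of the equivariant map. -/

section EquivariantMap

variable {V : Type*} {T : SimpleGraph V} {o : V} {G : Subgroup (rootedAut T o)}
  {X : Type*} [TopologicalSpace X]

theorem essentialSupport_eq_empty {φ : G →* (X ≃ₜ X)} {n : ℕ} (hn : 1 ≤ n)
    (h : ristLevel G n = ⊥) : essentialSupport G φ = ∅ := by
  refine Set.eq_empty_of_forall_notMem fun y hy => ?_
  have h1 := Set.mem_iInter₂.mp hy n hn
  refine notMem_actionSupport_iff.mpr ⟨Set.univ, Filter.univ_mem, ?_⟩ h1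
  rw [h, Subgroup.commutator_bot_left]
  exact bot_le

/-- The supports form a decreasing sequence of closed sets in a compact space. Each is non-empty,
since the derived subgroup is non-trivial and the action is faithful. -/
theorem essentialSupport_nonempty [CompactSpace X] (hT : T.IsTree)
    (hfin : ∀ v, (T.neighborSet v).Finite) (hG : IsBranchGroup G) (hL : HasUnboundedLevels T o)
    {φ : G →* (X ≃ₜ X)} (hφ : Function.Injective φ) : (essentialSupport G φ).Nonempty := by
  have h := IsCompact.nonempty_iInter_of_sequence_nonempty_isCompact_isClosed
    (fun n => actionSupport φ ⁅ristLevel G (n + 1), ristLevel G (n + 1)⁆) (fun n => ?_)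
    (fun n => ?_) (isClosed_actionSupport φ _).isCompact fun n => isClosed_actionSupport φ _
  · obtain ⟨y, hy⟩ := h
    refine ⟨y, Set.mem_iInter₂.mpr fun n hn => ?_⟩
    have h1 := Set.mem_iInter.mp hy (n - 1)
    rwa [Nat.sub_add_cancel hn] at h1
  · have h1 := ristLevel_anti (G := G) hT (Nat.le_succ (n + 1))
    exact actionSupport_mono φ (Subgroup.commutator_mono h1 h1)
  · by_contra hempty
    refine commutator_ristLevel_ne_bot hT hfin hG hL (Nat.le_add_left 1 n) ?_
    rw [eq_bot_iff]
    intro k hk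
    rw [Subgroup.mem_bot]
    apply hφ
    ext x
    rw [map_one_apply]
    by_contra hx
    exact hempty ⟨x, subset_closure fun hfix => hx (hfix k hk)⟩

/-- A choice of one vertex on each level on which a point accumulates is a ray. -/
def accumulationRay {φ : G →* (X ≃ₜ X)} {y : X} (hT : T.IsTree) (r : ℕ → V)
    (hr : ∀ n, r n ∈ treeLevel T o n) (hacc : ∀ n, AccumulatesAt φ (r n) y)
    (huniq : ∀ n, ∀ v ∈ treeLevel T o n, AccumulatesAt φ v y → v = r n) : TreeBoundary T o where
  vertex := r
  dist_root := hr
  adj n := by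
    have hd : T.dist o (r (n + 1)) = n + 1 := hr (n + 1)
    obtain ⟨u, hu, hur⟩ := exists_isBelow_of_le hT (o := o) (n := n) (w := r (n + 1)) (by omega)
    have h1 := huniq n u hu ((hacc (n + 1)).of_isBelow hT hur)
    subst h1
    rw [← SimpleGraph.dist_eq_one_iff_adj]
    have h2 : T.dist o (r n) = n := hr n
    unfold IsBelow at hur
    omega

end EquivariantMap

theorem mainTheorem9 {V : Type*} (T : SimpleGraph V) (hT : T.IsTree)
    (hfin : ∀ v, (T.neighborSet v).Finite) (o : V)
    (G : Subgroup (rootedAut T o)) (hGfg : Group.FG G) (hG : IsBranchGroup G)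
    {X : Type*} [TopologicalSpace X] [CompactSpace X] [TotallyDisconnectedSpace X]
    (H : Subgroup (X ≃ₜ X)) (hH : IsStronglyBoundedType H)
    (ρ : G →* H) (hρ : Function.Injective ρ) :
    ∃ q : essentialSupport G (H.subtype.comp ρ) → TreeBoundary T o,
      Continuous q ∧
      (∀ (g : G) (y : essentialSupport G (H.subtype.comp ρ)),
        q ⟨(ρ g : X ≃ₜ X) y, essentialSupport_invariant G (H.subtype.comp ρ) g y.2⟩ = g • q y) ∧
      (Infinite (TreeBoundary T o) → Function.Surjective q) := by

  set φ := H.subtype.comp ρ with hφ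
  have hφinj : Function.Injective φ := H.subtype_injective.comp hρ
  by_cases hL : HasUnboundedLevels T o
  swap
  -- Bounded levels: the essential support is empty and the boundary is finite.
  · obtain ⟨n, hn, hbot⟩ := exists_ristLevel_eq_bot hT hfin hG.1 hL
    have hempty : IsEmpty (essentialSupport G φ) :=
      Set.isEmpty_coe_sort.mpr (essentialSupport_eq_empty hn hbot)
    refine ⟨fun y => hempty.elim y, continuous_of_const fun y => hempty.elim y,
      fun _ y => hempty.elim y, fun _ => ?_⟩
    exact absurd (hasUnboundedLevels_of_infinite hT hfin) hL
  have hex : ∀ (y : essentialSupport G φ) (n : ℕ), ∃ v ∈ treeLevel T o n,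
      AccumulatesAt φ v (y : X) := fun y n =>
    exists_accumulatesAt_of_mem_essentialSupport hT hfin y.2 n
  choose r hr hacc using hex
  have huniq : ∀ (y : essentialSupport G φ) (n : ℕ), ∀ v ∈ treeLevel T o n,
      AccumulatesAt φ v (y : X) → v = r y n := fun y n v hv hv' =>
    hv'.eq_of_mem_treeLevel hT hfin hG hL hH hv (hr y n) (hacc y n)
  refine ⟨fun y => accumulationRay hT (r y) (hr y) (hacc y) (huniq y), ?_, ?_, ?_⟩
  · let : TopologicalSpace V := ⊥
    refine continuous_induced_rng.mpr (continuous_pi fun n => ?_)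
    rw [continuous_iff_isClosed]
    intro s _
    -- By uniqueness the preimage is a union of closed accumulation sets, finite because the level
    -- is finite.
    have h : (fun y : essentialSupport G φ => r y n) ⁻¹' s =
        Subtype.val ⁻¹' ⋃ v ∈ treeLevel T o n ∩ s, {y : X | AccumulatesAt φ v y} := by
      ext y
      simp only [Set.mem_preimage, Set.mem_iUnion]
      constructor
      · intro h
        exact ⟨r y n, ⟨hr y n, h⟩, hacc y n⟩
      · rintro ⟨v, ⟨hv, hvs⟩, h⟩
        exact huniq y n v hv h ▸ hvs
    change IsClosed ((fun y : essentialSupport G φ => r y n) ⁻¹' s)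
    rw [h]
    exact (Set.Finite.isClosed_biUnion ((finite_treeLevel hT hfin n).inter_of_left s)
      fun v _ => isClosed_setOf_accumulatesAt hT hfin φ v).preimage continuous_subtype_val
  · intro g y
    refine TreeBoundary.ext (funext fun n => Eq.symm ?_)
    exact huniq ⟨_, essentialSupport_invariant G φ g y.2⟩ n (g • r y n)
      (smul_mem_treeLevel g (hr y n)) ((hacc y n).smul g)
  · intro _ ξ
    obtain ⟨y₀, hy₀⟩ := essentialSupport_nonempty hT hfin hG hL hφinj
    have hclosed : IsClosed (essentialSupport G φ) :=
      isClosed_iInter fun n => isClosed_iInter fun _ => isClosed_actionSupport φ _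
    have hCclosed : ∀ n, IsClosed (essentialSupport G φ ∩ {y | AccumulatesAt φ (ξ.vertex n) y}) :=
      fun n => hclosed.inter (isClosed_setOf_accumulatesAt hT hfin φ _)
    -- The points at which the successive vertices of `ξ` accumulate form nested compact sets,
    -- non-empty because level transitivity moves the ray of `y₀` through `ξ.vertex n`. A common
    -- point has ray `ξ`.
    obtain ⟨y, hy⟩ := IsCompact.nonempty_iInter_of_sequence_nonempty_isCompact_isClosed
      (fun n => essentialSupport G φ ∩ {y | AccumulatesAt φ (ξ.vertex n) y})
      (fun n => Set.inter_subset_inter_right _ fun y hy =>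
        hy.of_isBelow hT (ξ.isBelow hT (Nat.le_succ n)))
      (fun n => by
        obtain ⟨g, hg⟩ := hG.1 n _ (hr ⟨y₀, hy₀⟩ n) (ξ.vertex n) (ξ.dist_root n)
        exact ⟨φ g y₀, essentialSupport_invariant G φ g hy₀, hg ▸ (hacc ⟨y₀, hy₀⟩ n).smul g⟩)
      (hCclosed 0).isCompact hCclosed
    rw [Set.mem_iInter] at hy
    refine ⟨⟨y, (hy 0).1⟩, TreeBoundary.ext (funext fun n => Eq.symm ?_)⟩
    exact huniq ⟨y, (hy 0).1⟩ n _ (ξ.dist_root n) (hy n).2
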